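/- Let $\mathcal E$ be a weakly idempotent complete, essentially small exact category (in the sense of Quillen); weakly idempotent complete means that, whenever $p\colon X\to Y$ and $i\colon Y\to X$ satisfy $pi=\mathrm{id}_Y$, the morphism $p$ has a kernel and $i$ has a cokernel. Let $\mathcal G$ be a family of objects of $\mathcal E$ that is a generator (every object $A$ admits a short exact sequence $A'\rightarrowtail G\twoheadrightarrow A$ with $G\in\mathcal G$) or a cogenerator (every object $A$ admits a short exact sequence $A\rightarrowtail G\twoheadrightarrow A'$ with $G\in\mathcal G$). Subcategories are full, additive and closed under isomorphisms; a subcategory is dense if every object of the ambient category is a direct summand of one of its objects. A subcategory of $\mathcal E$ is $\mathcal G$-resolving (resp. $\mathcal G$-coresolving) if it contains $\mathcal G$, is closed under extensions, and is closed under kernels of admissible epimorphisms (resp. cokernels of admissible monomorphisms). Let $\mathrm D^b(\mathcal E)$ be the bounded derived category, i.e. the Verdier quotient of the homotopy category of bounded complexes by the subcategory of complexes isomorphic to acyclic ones, and let $\iota\colon\mathcal E\to\mathrm D^b(\mathcal E)$ be the canonical functor. A subcategory of $\mathrm D^b(\mathcal E)$ contains $\mathcal G$ if it contains $\iota(G)$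 for all $G\in\mathcal G$. Let $\mathrm K_0$ denote Grothendieck groups (of an exact, resp. a triangulated category). Then $[A]\mapsto[\iota(A)]$ defines an isomorphism $\varphi\colon \mathrm K_0(\mathcal E)\to \mathrm K_0(\mathrm D^b(\mathcal E))$, and there are one-to-one correspondences among the following sets: 1. the dense $\mathcal G$-resolving subcategories of $\mathcal E$ (and likewise the dense $\mathcal G$-coresolving subcategories of $\mathcal E$); 2. the dense triangulated subcategories of $\mathrm D^b(\mathcal E)$ containing $\mathcal G$; 3. the subgroups of $\mathrm K_0(\mathcal E)$ containing $[G]$ for all $G\in\mathcal G$. Explicitly, $\mathcal X\mapsto\langle[X]\mid X\in\mathcal X\rangle$ and $H\mapsto\{A\in\mathcal E\mid[A]\in H\}$ are mutually inverse bijections between (1) and (3); $\mathcal Y\mapsto\varphi^{-1}\langle[Y]\mid Y\in\mathcal Y\rangle$ and $H\mapsto\{Y\mid[Y]\in\varphi(H)\}$ are mutually inverse bijections between (2) and (3); and $\mathcal Y\mapsto\{A\in\mathcal E\mid\iota(A)\in\mathcal Y\}$ and $\mathcal X\mapsto\{Y\mid[Y]\in\varphi\langle[X]\mid X\in\mathcal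 X\rangle\}$ are mutually inverse bijections between (2) and (1). -/

import Mathlib

open CategoryTheory Category Limits Pretriangulated ZeroObject

/-- A sequence `X₁ ⟶ X₂ ⟶ X₃` is a kernel-cokernel pair if its first map is a kernel of the
second one and its second map is a cokernel of the first one. -/
def IsKernelCokernelPair {C : Type*} [Category* C] [Preadditive C] (S : ShortComplex C) : Prop :=
  Nonempty (IsLimit (KernelFork.ofι S.f S.zero)) ∧
    Nonempty (IsColimit (CokernelCofork.ofπ S.g S.zero))

/-- The first map of a sequence in the class `P` (an admissible monomorphism). -/
def IsAdmissibleMono {C : Type*} [Category* C] [Preadditive C]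
    (P : ObjectProperty (ShortComplex C)) {X Y : C} (i : X ⟶ Y) : Prop :=
  ∃ (Z : C) (p : Y ⟶ Z) (w : i ≫ p = 0), P (ShortComplex.mk i p w)

/-- The second map of a sequence in the class `P` (an admissible epimorphism). -/
def IsAdmissibleEpi {C : Type*} [Category* C] [Preadditive C]
    (P : ObjectProperty (ShortComplex C)) {Y Z : C} (p : Y ⟶ Z) : Prop :=
  ∃ (X : C) (i : X ⟶ Y) (w : i ≫ p = 0), P (ShortComplex.mk i p w)

/-- An exact category in the sense of Quillen: an additive category with a class of
kernel-cokernel pairs (its short exact sequences), closed under isomorphisms, such that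
identities are admissible monomorphisms and admissible epimorphisms, each of these two classes is
closed under composition, pushouts of admissible monomorphisms along arbitrary morphisms exist
and are admissible monomorphisms, and dually. -/
class ExactCategory (C : Type*) [Category* C] [Preadditive C] [HasZeroObject C]
    [HasBinaryBiproducts C] where
  shortExact : ObjectProperty (ShortComplex C)
  of_iso : ∀ {S T : ShortComplex C}, (S ≅ T) → shortExact S → shortExact T
  isKernelCokernelPair : ∀ S : ShortComplex C, shortExact S → IsKernelCokernelPair S
  mono_id : ∀ X : C, IsAdmissibleMono shortExact (𝟙 X)
  epi_id : ∀ X : C, IsAdmissibleEpi shortExact (𝟙 X)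
  mono_comp : ∀ {X Y Z : C} (i : X ⟶ Y) (j : Y ⟶ Z), IsAdmissibleMono shortExact i →
    IsAdmissibleMono shortExact j → IsAdmissibleMono shortExact (i ≫ j)
  epi_comp : ∀ {X Y Z : C} (p : X ⟶ Y) (q : Y ⟶ Z), IsAdmissibleEpi shortExact p →
    IsAdmissibleEpi shortExact q → IsAdmissibleEpi shortExact (p ≫ q)
  exists_pushout : ∀ {X Y X' : C} (i : X ⟶ Y) (f : X ⟶ X'), IsAdmissibleMono shortExact i →
    ∃ (Y' : C) (f' : Y ⟶ Y') (i' : X' ⟶ Y'),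
      IsPushout i f f' i' ∧ IsAdmissibleMono shortExact i'
  exists_pullback : ∀ {Y Z Z' : C} (p : Y ⟶ Z) (f : Z' ⟶ Z), IsAdmissibleEpi shortExact p →
    ∃ (Y' : C) (f' : Y' ⟶ Y) (p' : Y' ⟶ Z'),
      IsPullback f' p' p f ∧ IsAdmissibleEpi shortExact p'

/-- Weak idempotent completeness: retractions have kernels and sections have cokernels. -/
def IsWeaklyIdempotentComplete (C : Type*) [Category* C] [Preadditive C] : Prop :=
  ∀ {X Y : C} (p : X ⟶ Y) (i : Y ⟶ X), i ≫ p = 𝟙 Y → HasKernel p ∧ HasCokernel i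

/-! ### Subcategories, identified with classes of objects -/

/-- A (strictly) full additive subcategory: it is closed under isomorphisms and contains the zero
objects and the direct sum of any two of its objects. -/
structure IsAdditiveSubcategory {C : Type*} [Category* C] [Preadditive C] [HasZeroObject C]
    [HasBinaryBiproducts C] (𝒳 : ObjectProperty C) : Prop where
  closedUnderIso : 𝒳.IsClosedUnderIsomorphisms
  containsZero : 𝒳.ContainsZero
  biprod : ∀ A B : C, 𝒳 A → 𝒳 B → 𝒳 (A ⊞ B)

/-- Density: any object is a direct summand of an object of the subcategory. -/
def IsDenseSubcategory {C : Type*} [Category* C] [Preadditive C]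
    [HasBinaryBiproducts C] (𝒳 : ObjectProperty C) : Prop :=
  ∀ A : C, ∃ A' B : C, 𝒳 B ∧ Nonempty (B ≅ A ⊞ A')

namespace ExactCategory

section Subcategories

variable {C : Type*} [Category* C] [Preadditive C] [HasZeroObject C] [HasBinaryBiproducts C]
  [ExactCategory C]

/-- `𝒢` is a generator: any object `A` has a short exact sequence `A' ↣ G ↠ A` with `G ∈ 𝒢`. -/
def IsGenerator (𝒢 : ObjectProperty C) : Prop :=
  ∀ A : C, ∃ S : ShortComplex C, shortExact S ∧ 𝒢 S.X₂ ∧ S.X₃ = A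

/-- `𝒢` is a cogenerator: any object `A` has a short exact sequence `A ↣ G ↠ A'`
with `G ∈ 𝒢`. -/
def IsCogenerator (𝒢 : ObjectProperty C) : Prop :=
  ∀ A : C, ∃ S : ShortComplex C, shortExact S ∧ 𝒢 S.X₂ ∧ S.X₁ = A

/-- `𝒢`-resolving subcategories: full additive subcategories containing `𝒢` and closed under
extensions and kernels of admissible epimorphisms. -/
structure IsResolving (𝒢 𝒳 : ObjectProperty C) : Prop where
  additive : IsAdditiveSubcategory 𝒳
  extension : ∀ S : ShortComplex C, shortExact S → 𝒳 S.X₁ → 𝒳 S.X₃ → 𝒳 S.X₂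
  kernel : ∀ S : ShortComplex C, shortExact S → 𝒳 S.X₂ → 𝒳 S.X₃ → 𝒳 S.X₁
  contains : ∀ A : C, 𝒢 A → 𝒳 A

/-- `𝒢`-coresolving subcategories: full additive subcategories containing `𝒢` and closed under
extensions and cokernels of admissible monomorphisms. -/
structure IsCoresolving (𝒢 𝒳 : ObjectProperty C) : Prop where
  additive : IsAdditiveSubcategory 𝒳
  extension : ∀ S : ShortComplex C, shortExact S → 𝒳 S.X₁ → 𝒳 S.X₃ → 𝒳 S.X₂
  cokernel : ∀ S : ShortComplex C, shortExact S → 𝒳 S.X₁ → 𝒳 S.X₂ → 𝒳 S.X₃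
  contains : ∀ A : C, 𝒢 A → 𝒳 A

variable (C) in
/-- The Grothendieck group: the free abelian group on the isomorphism classes of objects modulo
the relations `[A] - [B] + [C] = 0` for the short exact sequences `A ↣ B ↠ C`. -/
abbrev K₀ : Type _ :=
  FreeAbelianGroup (Quotient (isIsomorphicSetoid C)) ⧸
    AddSubgroup.closure {x | ∃ S : ShortComplex C, shortExact S ∧
      x = FreeAbelianGroup.of (Quotient.mk _ S.X₁) - FreeAbelianGroup.of (Quotient.mk _ S.X₂)
        + FreeAbelianGroup.of (Quotient.mk _ S.X₃)}

/-- The class `[A]` of an object in the Grothendieck group. -/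
def K₀.mk (A : C) : K₀ C :=
  QuotientAddGroup.mk (FreeAbelianGroup.of (Quotient.mk (isIsomorphicSetoid C) A))

end Subcategories

end ExactCategory

namespace TriangulatedCategory

section

variable {T : Type*} [Category* T] [Preadditive T] [HasZeroObject T] [HasShift T ℤ]
  [∀ n : ℤ, (shiftFunctor T n).Additive] [Pretriangulated T]

variable (T) in
/-- The Grothendieck group: the free abelian group on the isomorphism classes of objects modulo
the relations `[A] - [B] + [C] = 0` for the exact triangles `A → B → C → A[1]`. -/
abbrev K₀ : Type _ :=
  FreeAbelianGroup (Quotient (isIsomorphicSetoid T)) ⧸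
    AddSubgroup.closure {x | ∃ S : Triangle T, S ∈ distTriang T ∧
      x = FreeAbelianGroup.of (Quotient.mk _ S.obj₁) - FreeAbelianGroup.of (Quotient.mk _ S.obj₂)
        + FreeAbelianGroup.of (Quotient.mk _ S.obj₃)}

/-- The class `[A]` of an object in the Grothendieck group. -/
def K₀.mk (A : T) : K₀ T :=
  QuotientAddGroup.mk (FreeAbelianGroup.of (Quotient.mk (isIsomorphicSetoid T) A))

/-- (Strictly full) triangulated subcategories: closed under isomorphisms, containing the zero
objects, closed under all shifts and under extensions in exact triangles. -/
structure IsTriangulatedSubcategory (𝒴 : ObjectProperty T) : Prop where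
  closedUnderIso : 𝒴.IsClosedUnderIsomorphisms
  triangulated : 𝒴.IsTriangulated

end

end TriangulatedCategory

/-! ### Acyclic complexes -/

namespace ExactCategory

section Acyclic

variable {C : Type*} [Category* C] [Preadditive C] [HasZeroObject C] [HasBinaryBiproducts C]
  [ExactCategory C]

/-- A complex `N` is acyclic if every differential factors as `N ⁿ ↠ Z ⁿ⁺¹ ↣ N ⁿ⁺¹` in such a way
that all the sequences `Z ⁿ ↣ N ⁿ ↠ Z ⁿ⁺¹` are short exact. -/
def IsAcyclic (N : CochainComplex C ℤ) : Prop :=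
  ∃ (Z : ℤ → C) (i : ∀ n, Z n ⟶ N.X n) (p : ∀ n m, n + 1 = m → (N.X n ⟶ Z m)),
    (∀ n m (h : n + 1 = m), N.d n m = p n m h ≫ i m) ∧
    ∀ n m (h : n + 1 = m), ∃ w : i n ≫ p n m h = 0,
      shortExact (ShortComplex.mk (i n) (p n m h) w)

lemma shortExact_of_isos {S : ShortComplex C} (hS : shortExact S) {X Y Z : C} (i : X ⟶ Y)
    (p : Y ⟶ Z) (w : i ≫ p = 0) (e₁ : S.X₁ ≅ X) (e₂ : S.X₂ ≅ Y) (e₃ : S.X₃ ≅ Z)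
    (h₁ : e₁.hom ≫ i = S.f ≫ e₂.hom) (h₂ : e₂.hom ≫ p = S.g ≫ e₃.hom) :
    shortExact (ShortComplex.mk i p w) :=
  of_iso (T := ShortComplex.mk i p w) (ShortComplex.isoMk e₁ e₂ e₃ h₁ h₂) hS

lemma isAdmissibleEpi_of_isPullback {Y' Y Z' Z : C} {f' : Y' ⟶ Y} {p' : Y' ⟶ Z'} {p : Y ⟶ Z}
    {f : Z' ⟶ Z} (h : IsPullback f' p' p f) (hp : IsAdmissibleEpi shortExact p) :
    IsAdmissibleEpi shortExact p' := by
  obtain ⟨W, f'', p'', h', X, i, w, hS⟩ := exists_pullback p f hp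
  let e : W ≅ Y' := h'.isoIsPullback _ _ h
  have he : e.hom ≫ p' = p'' := by simp [e]
  refine ⟨X, i ≫ e.hom, by rw [assoc, he, w], ?_⟩
  exact shortExact_of_isos hS _ _ _ (Iso.refl _) e (Iso.refl _) (by simp) (by simp [he])

lemma shortExact_of_isLimit {X Y Z : C} (i : X ⟶ Y) (p : Y ⟶ Z) (w : i ≫ p = 0)
    (hp : IsAdmissibleEpi shortExact p)
    (hi : Nonempty (IsLimit (KernelFork.ofι i w))) : shortExact (ShortComplex.mk i p w) := by
  obtain ⟨X', i', w', hS⟩ := hp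
  obtain ⟨⟨h'⟩, -⟩ := isKernelCokernelPair _ hS
  obtain ⟨h⟩ := hi
  refine shortExact_of_isos hS _ _ _ (h'.conePointUniqueUpToIso h) (Iso.refl _) (Iso.refl _)
    ?_ (by simp)
  have := h'.conePointUniqueUpToIso_hom_comp h WalkingParallelPair.zero
  simp at this
  simpa using this

lemma mono_of_shortExact {S : ShortComplex C} (hS : shortExact S) : Mono S.f := by
  obtain ⟨⟨h⟩, -⟩ := isKernelCokernelPair _ hS
  exact ⟨fun a b hab => Fork.IsLimit.hom_ext h hab⟩

lemma exists_lift_of_shortExact {S : ShortComplex C} (hS : shortExact S) {A : C} (f : A ⟶ S.X₂)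
    (hf : f ≫ S.g = 0) : ∃ a : A ⟶ S.X₁, a ≫ S.f = f := by
  obtain ⟨⟨h⟩, -⟩ := isKernelCokernelPair _ hS
  exact ⟨h.lift (KernelFork.ofι f hf), h.fac _ WalkingParallelPair.zero⟩

lemma shortExact_zero {X Y Z : C} (hX : IsZero X) (hY : IsZero Y) (hZ : IsZero Z)
    (i : X ⟶ Y) (p : Y ⟶ Z) (w : i ≫ p = 0) : shortExact (ShortComplex.mk i p w) := by
  obtain ⟨Z', q, w', hS⟩ := mono_id X
  obtain ⟨-, ⟨h⟩⟩ := isKernelCokernelPair _ hS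
  have hZ' : IsZero Z' := by
    rw [IsZero.iff_id_eq_zero]
    exact Cofork.IsColimit.hom_ext h (hX.eq_of_src _ _)
  exact shortExact_of_isos hS _ _ _ (Iso.refl _) (hX.iso hY) (hZ'.iso hZ)
    (hX.eq_of_src _ _) (hX.eq_of_src _ _)

lemma isAcyclic_of_isZero (N : CochainComplex C ℤ) (hN : ∀ n, IsZero (N.X n)) : IsAcyclic N :=
  ⟨N.X, fun _ => 𝟙 _, fun _ _ _ => 0, fun n _ _ => (hN n).eq_of_src _ _,
    fun n m _ => ⟨by simp, shortExact_zero (hN n) (hN n) (hN m) _ _ _⟩⟩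

lemma IsAcyclic.shift {N : CochainComplex C ℤ} (hN : IsAcyclic N) (k : ℤ) :
    IsAcyclic (N⟦k⟧) := by
  obtain ⟨Z, i, p, hd, hS⟩ := hN
  refine ⟨fun n => Z (n + k), fun n => i (n + k),
    fun n m h => k.negOnePow • p (n + k) (m + k) (by lia), ?_, ?_⟩
  · intro n m h
    rw [CochainComplex.shiftFunctor_obj_d', hd (n + k) (m + k) (by lia)]
    exact (Linear.units_smul_comp _ _ _).symm
  · intro n m h
    obtain ⟨w, hw⟩ := hS (n + k) (m + k) (by lia)
    have w' : i (n + k) ≫ (k.negOnePow • p (n + k) (m + k) (by lia)) = 0 := by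
      rw [Linear.comp_units_smul, w, smul_zero]
    exact ⟨w', shortExact_of_isos hw (i (n + k)) _ w' (Iso.refl _) (Iso.refl _)
      (k.negOnePow • Iso.refl _) (by simp) (by simp)⟩

/-- The mapping cone of a morphism between acyclic complexes is acyclic. -/
lemma IsAcyclic.mappingCone {K L : CochainComplex C ℤ} (φ : K ⟶ L) (hK : IsAcyclic K)
    (hL : IsAcyclic L) : IsAcyclic (CochainComplex.mappingCone φ) := by
  obtain ⟨Z, i, p, hdK, hSK⟩ := hK
  obtain ⟨W, j, q, hdL, hSL⟩ := hL
  have hi : ∀ n, Mono (i n) := fun n => mono_of_shortExact (hSK n (n + 1) rfl).choose_spec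
  have hj : ∀ n, Mono (j n) := fun n => mono_of_shortExact (hSL n (n + 1) rfl).choose_spec
  have hq : ∀ n m h, IsAdmissibleEpi shortExact (q n m h) :=
    fun n m h => ⟨_, _, _, (hSL n m h).choose_spec⟩
  have hp : ∀ n m h, IsAdmissibleEpi shortExact (p n m h) :=
    fun n m h => ⟨_, _, _, (hSK n m h).choose_spec⟩
  have wK : ∀ n m h, i n ≫ p n m h = 0 := fun n m h => (hSK n m h).choose
  have wL : ∀ n m h, j n ≫ q n m h = 0 := fun n m h => (hSL n m h).choose
  have hζ : ∀ n, ∃ ζ : Z n ⟶ W n, ζ ≫ j n = i n ≫ φ.f n := by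
    intro n
    refine exists_lift_of_shortExact (hSL n (n + 1) rfl).choose_spec (i n ≫ φ.f n) ?_
    rw [← cancel_mono (j (n + 1))]
    dsimp
    rw [assoc, assoc, ← hdL, φ.comm, hdK n (n + 1) rfl, ← assoc, ← assoc, wK, zero_comp,
      zero_comp, zero_comp]
  choose ζ hζ using hζ
  have hζp : ∀ n m h, p n m h ≫ ζ m = φ.f n ≫ q n m h := by
    intro n m h
    rw [← cancel_mono (j m), assoc, hζ, ← assoc, ← hdK, assoc, ← hdL, φ.comm]
  have hV : ∀ n, ∃ (V : C) (a : V ⟶ L.X n) (b : V ⟶ Z (n + 1)),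
      IsPullback a b (q n (n + 1) rfl) (-ζ (n + 1)) := by
    intro n
    obtain ⟨V, a, b, h, -⟩ := exists_pullback (q n (n + 1) rfl) (-ζ (n + 1)) (hq _ _ _)
    exact ⟨V, a, b, h⟩
  choose V a b hV using hV
  let cst (n m : ℤ) (h : n + 1 = m) : (CochainComplex.mappingCone φ).X n ⟶ K.X m :=
    (CochainComplex.mappingCone.fst φ).1.v n m h
  let csn (n : ℤ) : (CochainComplex.mappingCone φ).X n ⟶ L.X n :=
    (CochainComplex.mappingCone.snd φ).v n n (add_zero n)
  let cil (n m : ℤ) (h : n + 1 = m) : K.X m ⟶ (CochainComplex.mappingCone φ).X n :=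
    (CochainComplex.mappingCone.inl φ).v m n (by lia)
  let cir (n : ℤ) : L.X n ⟶ (CochainComplex.mappingCone φ).X n :=
    (CochainComplex.mappingCone.inr φ).f n
  have c1 : ∀ n m h, cil n m h ≫ cst n m h = 𝟙 _ := fun n m h => by simp [cil, cst]
  have c2 : ∀ n m h, cil n m h ≫ csn n = 0 := fun n m h => by simp [cil, csn]
  have c3 : ∀ n m h, cir n ≫ cst n m h = 0 := fun n m h => by simp [cir, cst]
  have c4 : ∀ n, cir n ≫ csn n = 𝟙 _ := fun n => by simp [cir, csn]
  have cext : ∀ (n m : ℤ) (h : n + 1 = m) {A : C} (f g : A ⟶ (CochainComplex.mappingCone φ).X n),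
      f ≫ cst n m h = g ≫ cst n m h → f ≫ csn n = g ≫ csn n → f = g :=
    fun n m h A f g h₁ h₂ => CochainComplex.mappingCone.ext_to φ n m h h₁ h₂
  have cd1 : ∀ n m k h h', (CochainComplex.mappingCone φ).d n m ≫ cst m k h' =
      -(cst n m h ≫ K.d m k) :=
    fun n m k h h' => by
      simpa using CochainComplex.mappingCone.d_fst_v φ n m k h h'
  have cd2 : ∀ n m h, (CochainComplex.mappingCone φ).d n m ≫ csn m =
      cst n m h ≫ φ.f m + csn n ≫ L.d n m :=
    fun n m h => CochainComplex.mappingCone.d_snd_v φ n m h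
  clear_value cst csn cil cir
  have hπ : ∀ n m h, ∃ π : (CochainComplex.mappingCone φ).X n ⟶ V m,
      π ≫ a m = cst n m h ≫ φ.f m + csn n ≫ L.d n m ∧
      π ≫ b m = -(cst n m h ≫ p m (m + 1) rfl) := by
    intro n m h
    have hw : (cst n m h ≫ φ.f m + csn n ≫ L.d n m) ≫ q m (m + 1) rfl =
        (-(cst n m h ≫ p m (m + 1) rfl)) ≫ (-ζ (m + 1)) := by
      simp [hdL n m h, hζp, wL]
    exact ⟨(hV m).lift _ _ hw, (hV m).lift_fst _ _ hw, (hV m).lift_snd _ _ hw⟩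
  choose π hπa hπb using hπ
  refine ⟨V, fun n => b n ≫ i (n + 1) ≫ cil n (n + 1) rfl + a n ≫ cir n, π, ?_, ?_⟩
  · intro n m h
    apply cext m (m + 1) rfl
    · simp [cd1 n m (m + 1) h rfl, c1, c3, reassoc_of% hπb, hdK m (m + 1) rfl]
    · simp [cd2 n m h, c2, c4, hπa]
  · rintro n _ rfl
    have hπe : ∀ n m h, IsAdmissibleEpi shortExact (π n m h) := by
      intro n m h
      let r : (CochainComplex.mappingCone φ).X n ⟶ K.X m ⊞ W m :=
        biprod.lift (cst n m h) (csn n ≫ q n m h)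
      have hr : IsPullback (csn n) r (q n m h) biprod.snd := by
        refine IsPullback.of_isLimit' ⟨by simp [r]⟩ (PullbackCone.IsLimit.mk _
          (fun s => (s.snd ≫ biprod.fst) ≫ cil n m h + s.fst ≫ cir n) ?_ ?_ ?_)
        · intro s
          simp [c2, c4]
        · intro s
          have := s.condition
          ext <;> simp [r, c1, c3, reassoc_of% c2, reassoc_of% c4, this]
        · intro s t h₁ h₂
          apply cext n m h
          · simp [c1, c3, ← h₂, r]
          · simp [c2, c4, h₁]
      have hs' : (biprod.fst ≫ φ.f m + biprod.snd ≫ j m : K.X m ⊞ W m ⟶ L.X m) ≫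
          q m (m + 1) rfl = (-(biprod.fst ≫ p m (m + 1) rfl)) ≫ (-ζ (m + 1)) := by
        simp [hζp, wL]
      obtain ⟨s, hsa, hsb⟩ : ∃ s : K.X m ⊞ W m ⟶ V m,
          s ≫ a m = biprod.fst ≫ φ.f m + biprod.snd ≫ j m ∧
          s ≫ b m = -(biprod.fst ≫ p m (m + 1) rfl) :=
        ⟨(hV m).lift _ _ hs', (hV m).lift_fst _ _ hs', (hV m).lift_snd _ _ hs'⟩
      have hs : IsPullback biprod.fst s (p m (m + 1) rfl) (-b m) := by
        have hl : ∀ t : PullbackCone (p m (m + 1) rfl) (-b m),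
            ∃ u : t.pt ⟶ W m, u ≫ j m = t.snd ≫ a m - t.fst ≫ φ.f m := by
          intro t
          refine exists_lift_of_shortExact (hSL m (m + 1) rfl).choose_spec _ ?_
          have := t.condition
          dsimp
          rw [Preadditive.sub_comp, assoc, assoc, (hV m).w, ← hζp, reassoc_of% this]
          simp
        choose u hu using hl
        refine IsPullback.of_isLimit' ⟨by simp [hsb]⟩ (PullbackCone.IsLimit.mk _
          (fun t => biprod.lift t.fst (u t)) ?_ ?_ ?_)
        · intro t
          simp
        · intro t
          apply (hV m).hom_ext
          · simp [hsa, hu]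
          · simp [hsb, t.condition]
        · intro t v h₁ h₂
          ext
          · simpa using h₁
          · rw [← cancel_mono (j m)]
            simp [hu, ← h₁, ← h₂, hsa]
      have : π n m h = r ≫ s := by
        apply (hV m).hom_ext
        · simp [hπa, hsa, r, hdL n m h]
        · simp [hπb, hsb, r]
      rw [this]
      exact epi_comp _ _ (isAdmissibleEpi_of_isPullback hr (hq _ _ _))
        (isAdmissibleEpi_of_isPullback hs (hp _ _ _))
    have hmono : Mono (b n ≫ i (n + 1) ≫ cil n (n + 1) rfl + a n ≫ cir n) := by
      refine ⟨fun u v huv => ?_⟩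
      have h₁ := huv =≫ cst n (n + 1) rfl
      have h₂ := huv =≫ csn n
      apply (hV n).hom_ext
      · simpa [c2, c4] using h₂
      · rw [← cancel_mono (i (n + 1))]
        simpa [c1, c3] using h₁
    have hw : (b n ≫ i (n + 1) ≫ cil n (n + 1) rfl + a n ≫ cir n) ≫ π n (n + 1) rfl = 0 := by
      apply (hV (n + 1)).hom_ext
      · have := (hV n).w
        simp [hπa, reassoc_of% c1, reassoc_of% c2, reassoc_of% c3, reassoc_of% c4,
          hdL n (n + 1) rfl, ← hζ, reassoc_of% this]
      · simp [hπb, reassoc_of% c1, reassoc_of% c3, wK]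
    refine ⟨hw, shortExact_of_isLimit _ _ hw (hπe _ _ _)
      ⟨KernelFork.IsLimit.ofι' _ hw (fun {A} k hk => Classical.indefiniteDescription _ ?_)⟩⟩
    have h₁ := hk =≫ a (n + 1)
    have h₂ := hk =≫ b (n + 1)
    obtain ⟨z, hz⟩ := exists_lift_of_shortExact (hSK (n + 1) (n + 1 + 1) rfl).choose_spec
      (k ≫ cst n (n + 1) rfl) (by simpa [hπb] using h₂)
    dsimp at z hz
    have hl : (k ≫ csn n) ≫ q n (n + 1) rfl = z ≫ (-ζ (n + 1)) := by
      rw [← cancel_mono (j (n + 1))]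
      simp only [assoc, hπa, Preadditive.comp_add, zero_comp] at h₁
      simp only [assoc, Preadditive.neg_comp, Preadditive.comp_neg, hζ, reassoc_of% hz,
        ← hdL n (n + 1) rfl]
      exact eq_neg_of_add_eq_zero_right h₁
    refine ⟨(hV n).lift _ _ hl, ?_⟩
    apply cext n (n + 1) rfl
    · simp [c1, c3, ← hz]
    · simp [c2, c4]
end Acyclic

/-! ### The bounded derived category -/

section Bounded

variable (C : Type*) [Category* C] [Preadditive C]

/-- The complexes `K` with `K.X n = 0` for all but finitely many `n`, as objects of the homotopy
category. -/
def bounded : ObjectProperty (HomotopyCategory C (ComplexShape.up ℤ)) :=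
  fun K => ∃ a b : ℤ, ∀ n, n < a ∨ b < n → IsZero (K.as.X n)

lemma bounded_mappingCone [HasBinaryBiproducts C] {K L : CochainComplex C ℤ} (φ : K ⟶ L)
    (hK : bounded C ((HomotopyCategory.quotient _ _).obj K))
    (hL : bounded C ((HomotopyCategory.quotient _ _).obj L)) :
    bounded C ((HomotopyCategory.quotient _ _).obj (CochainComplex.mappingCone φ)) := by
  obtain ⟨a, b, h⟩ := hK
  obtain ⟨a', b', h'⟩ := hL
  refine ⟨min (a - 1) a', max b b', fun n hn => ?_⟩
  exact (CochainComplex.mappingCone.isZero_X_iff φ n).2 ⟨h _ (by grind), h' _ (by grind)⟩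

variable [HasZeroObject C]

instance : (bounded C).ContainsZero where
  exists_zero :=
    ⟨(HomotopyCategory.quotient _ _).obj 0, Functor.map_isZero _ (isZero_zero _), 0, 0,
      fun n _ => (HomologicalComplex.eval C (ComplexShape.up ℤ) n).map_isZero (isZero_zero _)⟩

instance : (bounded C).IsStableUnderShift ℤ where
  isStableUnderShiftBy k :=
    { le_shift K hK := by
        obtain ⟨K : CochainComplex _ _, rfl⟩ := K.quotient_obj_surjective
        obtain ⟨a, b, h⟩ := hK
        rw [ObjectProperty.prop_shift_iff, HomotopyCategory.shift_quotient_obj]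
        exact ⟨a - k, b - k, fun n hn => h (n + k) (by lia)⟩ }

variable [HasBinaryBiproducts C]

variable {C} in
/-- The third object of an exact triangle in the homotopy category is a mapping cone. -/
lemma exists_iso_mappingCone (T : Triangle (HomotopyCategory C (ComplexShape.up ℤ)))
    (hT : T ∈ distTriang _) : ∃ f : T.obj₁.as ⟶ T.obj₂.as, Nonempty
      (T.obj₃ ≅ (HomotopyCategory.quotient _ _).obj (CochainComplex.mappingCone f)) := by
  obtain ⟨f : T.obj₁.as ⟶ T.obj₂.as, hf⟩ :=
    (HomotopyCategory.quotient _ _).map_surjective T.mor₁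
  exact ⟨f, ⟨Triangle.π₃.mapIso (isoTriangleOfIso₁₂ T _ hT
    (HomotopyCategory.mappingCone_triangleh_distinguished f)
    (Iso.refl _) (Iso.refl _) (by
      change T.mor₁ ≫ 𝟙 _ = 𝟙 _ ≫ (HomotopyCategory.quotient _ _).map f
      rw [hf]; exact (comp_id _).trans (id_comp _).symm))⟩⟩

instance : (bounded C).IsTriangulatedClosed₃ where
  ext₃' T hT h₁ h₂ := by
    obtain ⟨f, ⟨e⟩⟩ := exists_iso_mappingCone T hT
    exact ⟨_, bounded_mappingCone C f h₁ h₂, ⟨e⟩⟩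

instance : (bounded C).IsTriangulated where
  toIsTriangulatedClosed₂ := .of_isTriangulatedClosed₃

/-- The homotopy category `Kᵇ(C)` of bounded complexes. -/
abbrev Kb := (bounded C).FullSubcategory

variable [ExactCategory C]

/-- The triangulated subcategory of `Kᵇ(C)` of the complexes that are isomorphic in `Kᵇ(C)` to an
acyclic complex. -/
def Kac : ObjectProperty (Kb C) :=
  fun N => ∃ M : Kb C, IsAcyclic M.obj.as ∧ Nonempty (N ≅ M)

instance : (Kac C).IsClosedUnderIsomorphisms where
  of_iso := by
    rintro N N' e ⟨M, hM, ⟨e'⟩⟩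
    exact ⟨M, hM, ⟨e.symm ≪≫ e'⟩⟩

instance : (Kac C).ContainsZero where
  exists_zero := by
    have h0 : ∀ n, IsZero ((0 : CochainComplex C ℤ).X n) := fun n =>
      (HomologicalComplex.eval C (ComplexShape.up ℤ) n).map_isZero (isZero_zero _)
    refine ⟨⟨(HomotopyCategory.quotient _ _).obj 0, 0, 0, fun n _ => h0 n⟩, ?_,
      _, isAcyclic_of_isZero _ h0, ⟨Iso.refl _⟩⟩
    rw [IsZero.iff_id_eq_zero]
    apply (bounded C).ι.map_injective
    exact (Functor.map_isZero (HomotopyCategory.quotient _ _) (isZero_zero _)).eq_of_src _ _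

instance : (Kac C).IsStableUnderShift ℤ where
  isStableUnderShiftBy k :=
    { le_shift := by
        rintro N ⟨⟨M, hb⟩, hM, ⟨e⟩⟩
        obtain ⟨M : CochainComplex _ _, rfl⟩ := M.quotient_obj_surjective
        have hb' := (bounded C).le_shift k _ hb
        rw [ObjectProperty.prop_shift_iff, HomotopyCategory.shift_quotient_obj] at hb'
        refine ⟨⟨_, hb'⟩, hM.shift k, ⟨(shiftFunctor (Kb C) k).mapIso e ≪≫ ?_⟩⟩
        exact (bounded C).ι.preimageIso (((bounded C).ι.commShiftIso k).app _ ≪≫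
          eqToIso (HomotopyCategory.shift_quotient_obj M k)) }

instance : (Kac C).IsTriangulatedClosed₃ :=
  .mk' (by
    rintro T hT ⟨M₁, hM₁, ⟨e₁⟩⟩ ⟨M₂, hM₂, ⟨e₂⟩⟩
    let T' : Triangle (Kb C) := Triangle.mk (e₁.inv ≫ T.mor₁ ≫ e₂.hom) (e₂.inv ≫ T.mor₂)
      (T.mor₃ ≫ e₁.hom⟦1⟧')
    have hT' : T' ∈ distTriang _ := isomorphic_distinguished _ hT _
      (Triangle.isoMk T' T e₁.symm e₂.symm (Iso.refl _)
        (show (e₁.inv ≫ T.mor₁ ≫ e₂.hom) ≫ e₂.inv = e₁.inv ≫ T.mor₁ by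
          simp only [assoc, Iso.hom_inv_id, comp_id])
        (show (e₂.inv ≫ T.mor₂) ≫ 𝟙 T.obj₃ = e₂.inv ≫ T.mor₂ from comp_id _)
        (show (T.mor₃ ≫ e₁.hom⟦1⟧') ≫ e₁.inv⟦1⟧' = 𝟙 T.obj₃ ≫ T.mor₃ by
          simp only [assoc, ← Functor.map_comp, Iso.hom_inv_id,
            CategoryTheory.Functor.map_id, comp_id, id_comp]))
    obtain ⟨f, ⟨e⟩⟩ := exists_iso_mappingCone _ ((bounded C).ι.map_distinguished T' hT')
    exact ⟨⟨_, bounded_mappingCone C f M₁.property M₂.property⟩,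
      IsAcyclic.mappingCone f hM₁ hM₂, ⟨(bounded C).ι.preimageIso e⟩⟩)

instance : (Kac C).IsTriangulated where
  toIsTriangulatedClosed₂ := .of_isTriangulatedClosed₃

/-- The bounded derived category `Dᵇ(C)`: the Verdier quotient of `Kᵇ(C)` by `Kac C`, that is, the
localization at the morphisms whose cone lies in `Kac C`, with the induced triangulated
structure. -/
abbrev Db := (Kac C).trW.Localization

/-- The functor `C ⥤ Kᵇ(C)` sending an object to the complex concentrated in degree `0`. -/
noncomputable def toKb : C ⥤ Kb C :=
  (bounded C).lift (HomotopyCategory.singleFunctor C 0)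
    (fun A => ⟨0, 0, fun n hn => HomologicalComplex.isZero_single_obj_X (ComplexShape.up ℤ) 0 A n
      (by lia)⟩)

/-- The canonical functor `C ⥤ Dᵇ(C)`. -/
noncomputable def toDb : C ⥤ Db C := toKb C ⋙ (Kac C).trW.Q

end Bounded

/-! ### The three sets and the maps between them -/

section Correspondences

variable {C : Type*} [Category* C] [Preadditive C] [HasZeroObject C] [HasBinaryBiproducts C]
  [ExactCategory C]

/-- The dense `𝒢`-resolving subcategories. -/
def denseResolving (𝒢 : ObjectProperty C) : Set (ObjectProperty C) :=
  {𝒳 | IsDenseSubcategory 𝒳 ∧ IsResolving 𝒢 𝒳}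

/-- The dense `𝒢`-coresolving subcategories. -/
def denseCoresolving (𝒢 : ObjectProperty C) : Set (ObjectProperty C) :=
  {𝒳 | IsDenseSubcategory 𝒳 ∧ IsCoresolving 𝒢 𝒳}

/-- The dense triangulated subcategories of `Dᵇ(C)` containing `𝒢`. -/
def denseTriangulated (𝒢 : ObjectProperty C) : Set (ObjectProperty (Db C)) :=
  {𝒴 | IsDenseSubcategory 𝒴 ∧ TriangulatedCategory.IsTriangulatedSubcategory 𝒴 ∧
    ∀ A : C, 𝒢 A → 𝒴 ((toDb C).obj A)}

/-- The subgroups of `K₀(C)` containing the image of `𝒢`. -/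
def subgroupsContaining (𝒢 : ObjectProperty C) : Set (AddSubgroup (K₀ C)) :=
  {H | ∀ A : C, 𝒢 A → K₀.mk A ∈ H}

/-- The subgroup `⟨[X] | X ∈ 𝒳⟩` of the Grothendieck group. -/
def K₀.span (𝒳 : ObjectProperty C) : AddSubgroup (K₀ C) :=
  AddSubgroup.closure {x | ∃ X : C, 𝒳 X ∧ x = K₀.mk X}

/-- The objects whose class lies in the subgroup `H`. -/
def K₀.objects (H : AddSubgroup (K₀ C)) : ObjectProperty C := fun A => K₀.mk A ∈ H

end Correspondences

end ExactCategory

namespace TriangulatedCategory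

section

variable {T : Type*} [Category* T] [Preadditive T] [HasZeroObject T] [HasShift T ℤ]
  [∀ n : ℤ, (shiftFunctor T n).Additive] [Pretriangulated T]

/-- The subgroup `⟨[Y] | Y ∈ 𝒴⟩` of the Grothendieck group. -/
def K₀.span (𝒴 : ObjectProperty T) : AddSubgroup (K₀ T) :=
  AddSubgroup.closure {x | ∃ Y : T, 𝒴 Y ∧ x = K₀.mk Y}

/-- The objects whose class lies in the subgroup `H`. -/
def K₀.objects (H : AddSubgroup (K₀ T)) : ObjectProperty T := fun Y => K₀.mk Y ∈ H

end

end TriangulatedCategory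

universe w v u

/-!
The isomorphism `K₀(C) ≃ K₀(Dᵇ(C))` sends `[A]` to the class of `A` in degree `0`; its inverse is
the Euler characteristic `N ↦ ∑ (-1)ⁿ [Nⁿ]`.

The Euler characteristic is additive on mapping cones and vanishes on bounded acyclic complexes, so
the point is that it only depends on the isomorphism class of a complex in `Dᵇ(C)`. This is where
weak idempotent completeness enters. By `isAdmissibleMono_of_comp`, a morphism `f` is an admissible
monomorphism if `f ≫ g` is one and `g` is a split monomorphism. Hence a bounded below retract, up
to homotopy, of an acyclic complex is acyclic (`IsAcyclic.of_homotopy_retract`); so `Kac C` consists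
of acyclic complexes, contractible complexes have Euler characteristic zero, and `Kac C` is closed
under direct summands (`isAcyclic_of_retract_Kac`). The last property implies that a morphism of
`Kᵇ(C)` which becomes invertible in `Dᵇ(C)` has its cone in `Kac C` (`trW_of_isIso_Q_map`).

In the other direction, brutal truncations show that the class in `K₀(Dᵇ(C))` of any bounded complex
is the alternating sum of the classes of its terms (`derivedClass_eq_finsum`). Applied to a
conflation, viewed as a three-term acyclic complex, this says that `A ↦ [ι A]` is additive on
conflations; applied to an arbitrary complex, it says that the two homomorphisms are mutually
inverse.

The correspondences between subcategories and subgroups follow Thomason. The essential point is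
that a dense subcategory `𝒳` closed under the relevant operations contains every `A` with
`[A] ∈ ⟨[X] | X ∈ 𝒳⟩`. Isomorphism classes of objects form a commutative monoid in which, by
density, every element has a complement in the submonoid of classes of objects of `𝒳`. Dividing by
this submonoid gives an abelian group in which all the defining relations of the Grothendieck group
hold, and therefore `A ⊞ X` is isomorphic to an object of `𝒳` for some `X` in `𝒳`
(`GrothendieckGroup.exists_iso_of_mem_closure`). The split sequence of `A ⊞ X`, taken in the
appropriate order, then shows that `A` is in `𝒳`, whether `𝒳` is resolving, coresolving or
triangulated. Conversely, the generator or cogenerator provides, for every object `A`, an object `B`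
with `[A] + [B]` in the given subgroup; in a triangulated category `B = A⟦1⟧` always works. The
bijection between dense triangulated and dense (co)resolving subcategories is the composite of the
two bijections with subgroups.
-/

/-! ### Grothendieck groups of commutative monoids with relations -/

namespace GrothendieckGroup

section Algebra

variable {M J : Type*}

/-- The abelian group generated by `M` with the relations `[f₁ j] - [f₂ j] + [f₃ j] = 0` for the
indices `j` satisfying `P`. Both Grothendieck groups in use are instances of it, with `M` the
isomorphism classes of objects. -/
abbrev Presented (P : J → Prop) (f₁ f₂ f₃ : J → M) : Type _ :=
  FreeAbelianGroup M ⧸ AddSubgroup.closure {x | ∃ j : J, P j ∧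
    x = FreeAbelianGroup.of (f₁ j) - FreeAbelianGroup.of (f₂ j) + FreeAbelianGroup.of (f₃ j)}

variable {P : J → Prop} {f₁ f₂ f₃ : J → M}

/-- The homomorphism induced by an additive function on the generators. -/
noncomputable def Presented.lift {A : Type*} [AddCommGroup A] (g : M → A)
    (hg : ∀ j, P j → g (f₂ j) = g (f₁ j) + g (f₃ j)) : Presented P f₁ f₂ f₃ →+ A :=
  QuotientAddGroup.lift _ (FreeAbelianGroup.lift g) (by
    rw [AddSubgroup.closure_le]
    rintro _ ⟨j, hj, rfl⟩
    simp [hg j hj, AddMonoidHom.mem_ker])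

@[simp]
lemma Presented.lift_mk {A : Type*} [AddCommGroup A] (g : M → A)
    (hg : ∀ j, P j → g (f₂ j) = g (f₁ j) + g (f₃ j)) (m : M) :
    Presented.lift g hg
      (QuotientAddGroup.mk (FreeAbelianGroup.of m) : Presented P f₁ f₂ f₃) = g m :=
  FreeAbelianGroup.lift_apply_of g m

lemma Presented.mk_eq (j : J) (hj : P j) :
    (QuotientAddGroup.mk (FreeAbelianGroup.of (f₂ j)) : Presented P f₁ f₂ f₃) =
      QuotientAddGroup.mk (FreeAbelianGroup.of (f₁ j)) +
        QuotientAddGroup.mk (FreeAbelianGroup.of (f₃ j)) := by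
  have : (QuotientAddGroup.mk (FreeAbelianGroup.of (f₁ j) - FreeAbelianGroup.of (f₂ j) +
      FreeAbelianGroup.of (f₃ j)) : Presented P f₁ f₂ f₃) = 0 :=
    (QuotientAddGroup.eq_zero_iff _).2 (AddSubgroup.subset_closure ⟨j, hj, rfl⟩)
  rw [QuotientAddGroup.mk_add, QuotientAddGroup.mk_sub] at this
  rw [← sub_eq_zero, ← neg_eq_zero, ← this]
  abel

lemma Presented.induction {p : Presented P f₁ f₂ f₃ → Prop} (zero : p 0)
    (of : ∀ m, p (QuotientAddGroup.mk (FreeAbelianGroup.of m)))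
    (neg : ∀ x, p x → p (-x)) (add : ∀ x y, p x → p y → p (x + y))
    (x : Presented P f₁ f₂ f₃) : p x := by
  obtain ⟨x, rfl⟩ := QuotientAddGroup.mk_surjective x
  induction x using FreeAbelianGroup.induction_on with
  | zero => exact zero
  | of m => exact of m
  | neg m h => exact neg _ h
  | add x y hx hy => exact add _ _ hx hy

/-- The congruence `a ∼ b` if `a + s = b + t` with `s, t ∈ S`. -/
def conOfSubmonoid [AddCommMonoid M] (S : AddSubmonoid M) : AddCon M where
  r a b := ∃ s ∈ S, ∃ t ∈ S, a + s = b + t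
  iseqv :=
    { refl := fun _ => ⟨0, S.zero_mem, 0, S.zero_mem, rfl⟩
      symm := fun ⟨s, hs, t, ht, h⟩ => ⟨t, ht, s, hs, h.symm⟩
      trans := fun {a b c} ⟨s, hs, t, ht, h⟩ ⟨s', hs', t', ht', h'⟩ =>
        ⟨s + s', S.add_mem hs hs', t' + t, S.add_mem ht' ht, by
          rw [← add_assoc, h, add_right_comm, h', add_assoc]⟩ }
  add' := fun {a b c d} ⟨s, hs, t, ht, h⟩ ⟨s', hs', t', ht', h'⟩ =>
    ⟨s + s', S.add_mem hs hs', t + t', S.add_mem ht ht', by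
      rw [add_add_add_comm, h, h', add_add_add_comm]⟩

/-- If every element of `M` has a complement in the submonoid `S` and the relations are compatible
with `S`, then the elements of `M` whose class lies in the subgroup generated by `S` are stably
in `S`: the quotient of `M` by the congruence attached to `S` is a group in which the relations
hold and `S` dies. -/
lemma exists_add_eq_of_mem_closure [AddCommMonoid M] (S : AddSubmonoid M)
    (hS : ∀ a, ∃ b, a + b ∈ S)
    (hP : ∀ j, P j → ∀ a c, f₁ j + a ∈ S → f₃ j + c ∈ S → f₂ j + (a + c) ∈ S) (a : M)
    (ha : (QuotientAddGroup.mk (FreeAbelianGroup.of a) : Presented P f₁ f₂ f₃) ∈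
      AddSubgroup.closure {x | ∃ s ∈ S, x = QuotientAddGroup.mk (FreeAbelianGroup.of s)}) :
    ∃ s ∈ S, ∃ t ∈ S, a + s = t := by
  have hzero : ∀ s ∈ S, ((s : M) : (conOfSubmonoid S).Quotient) = 0 := fun s hs =>
    (AddCon.eq _).2 ⟨0, S.zero_mem, s, hs, by rw [add_zero, zero_add]⟩
  choose c hc using hS
  have hneg : ∀ x : (conOfSubmonoid S).Quotient, ∃ y, y + x = 0 := by
    intro x
    induction x using AddCon.induction_on with
    | H x => exact ⟨((c x : M) : (conOfSubmonoid S).Quotient), by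
        rw [← AddCon.coe_add, add_comm]; exact hzero _ (hc x)⟩
  choose neg hneg using hneg
  let _ : AddCommGroup (conOfSubmonoid S).Quotient :=
    { (inferInstance : AddCommMonoid (conOfSubmonoid S).Quotient) with
      neg := neg
      zsmul := @zsmulRec _ _ _ ⟨neg⟩ nsmulRec
      neg_add_cancel := hneg }
  let g : Presented P f₁ f₂ f₃ →+ (conOfSubmonoid S).Quotient :=
    Presented.lift (fun m => (m : (conOfSubmonoid S).Quotient)) (fun j hj => by
      rw [← AddCon.coe_add]
      refine (AddCon.eq _).2 ⟨(f₁ j + c (f₁ j)) + (f₃ j + c (f₃ j)), S.add_mem (hc _) (hc _),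
        f₂ j + (c (f₁ j) + c (f₃ j)), hP j hj _ _ (hc _) (hc _), ?_⟩
      rw [add_add_add_comm (f₁ j), add_left_comm])
  have hg : AddSubgroup.closure {x | ∃ s ∈ S, x = QuotientAddGroup.mk (FreeAbelianGroup.of s)} ≤
      g.ker := by
    rw [AddSubgroup.closure_le]
    rintro _ ⟨s, hs, rfl⟩
    exact (Presented.lift_mk _ _ _).trans (hzero s hs)
  have h0 : ((a : M) : (conOfSubmonoid S).Quotient) = ((0 : M) : (conOfSubmonoid S).Quotient) :=
    (Presented.lift_mk _ _ _).symm.trans (hg ha)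
  obtain ⟨s, hs, t, ht, h⟩ := (AddCon.eq _).1 h0
  exact ⟨s, hs, t, ht, by rw [h, zero_add]⟩

end Algebra

/-! ### Isomorphism classes of objects of an additive category -/

section IsoClasses

variable {C : Type*} [Category* C]

/-- The isomorphism class of an object. -/
abbrev isoClass (A : C) : Quotient (isIsomorphicSetoid C) := Quotient.mk _ A

lemma isoClass_eq {A B : C} (e : A ≅ B) : isoClass A = isoClass B := Quotient.sound ⟨e⟩

lemma nonempty_iso_of_isoClass_eq {A B : C} (h : isoClass A = isoClass B) : Nonempty (A ≅ B) :=
  Quotient.exact h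

variable [Preadditive C] [HasZeroObject C] [HasBinaryBiproducts C]

noncomputable instance : Zero (Quotient (isIsomorphicSetoid C)) := ⟨isoClass 0⟩

noncomputable instance : Add (Quotient (isIsomorphicSetoid C)) :=
  ⟨Quotient.map₂ (fun A B => A ⊞ B) (fun _ _ ⟨e⟩ _ _ ⟨e'⟩ => ⟨biprod.mapIso e e'⟩)⟩

/-- The commutative monoid of isomorphism classes of objects under direct sums. -/
noncomputable instance : AddCommMonoid (Quotient (isIsomorphicSetoid C)) where
  add_assoc := by
    rintro ⟨A⟩ ⟨B⟩ ⟨D⟩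
    exact isoClass_eq (biprod.associator A B D)
  add_comm := by
    rintro ⟨A⟩ ⟨B⟩
    exact isoClass_eq (biprod.braiding A B)
  zero_add := by
    rintro ⟨A⟩
    exact isoClass_eq (isoZeroBiprod (isZero_zero C)).symm
  add_zero := by
    rintro ⟨A⟩
    exact isoClass_eq (isoBiprodZero (isZero_zero C)).symm
  nsmul := nsmulRec

/-- Categorical form of `exists_add_eq_of_mem_closure`: an object whose class lies in the subgroup
generated by a dense additive subcategory `𝒳` becomes an object of `𝒳` after adding some object
of `𝒳`. -/
lemma exists_iso_of_mem_closure {𝒳 : ObjectProperty C} (h𝒳 : IsAdditiveSubcategory 𝒳)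
    (hd : IsDenseSubcategory 𝒳) {J : Type*} {P : J → Prop} {X₁ X₂ X₃ : J → C}
    (hP : ∀ j, P j → ∀ A B, 𝒳 (X₁ j ⊞ A) → 𝒳 (X₃ j ⊞ B) → 𝒳 (X₂ j ⊞ (A ⊞ B))) (A : C)
    (hA : (QuotientAddGroup.mk (FreeAbelianGroup.of (isoClass A)) :
      Presented P (fun j => isoClass (X₁ j)) (fun j => isoClass (X₂ j))
        (fun j => isoClass (X₃ j))) ∈ AddSubgroup.closure
        {x | ∃ X, 𝒳 X ∧ x = QuotientAddGroup.mk (FreeAbelianGroup.of (isoClass X))}) :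
    ∃ X Y, 𝒳 X ∧ 𝒳 Y ∧ Nonempty (A ⊞ X ≅ Y) := by
  have := h𝒳.closedUnderIso
  have := h𝒳.containsZero
  have hmem : ∀ B : C, isoClass B ∈ {m | ∃ X, 𝒳 X ∧ isoClass X = m} ↔ 𝒳 B := fun B =>
    ⟨fun ⟨X, hX, h⟩ => 𝒳.prop_of_iso (nonempty_iso_of_isoClass_eq h).some hX,
      fun h => ⟨B, h, rfl⟩⟩
  let S : AddSubmonoid (Quotient (isIsomorphicSetoid C)) :=
    { carrier := {m | ∃ X, 𝒳 X ∧ isoClass X = m}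
      add_mem' := by
        rintro _ _ ⟨X, hX, rfl⟩ ⟨Y, hY, rfl⟩
        exact ⟨X ⊞ Y, h𝒳.biprod _ _ hX hY, rfl⟩
      zero_mem' := ⟨0, 𝒳.prop_zero, rfl⟩ }
  obtain ⟨_, ⟨X, hX, rfl⟩, _, ⟨Y, hY, rfl⟩, h⟩ := exists_add_eq_of_mem_closure S
    (by
      rintro ⟨B⟩
      obtain ⟨B', D, hD, ⟨e⟩⟩ := hd B
      exact ⟨isoClass B', D, hD, isoClass_eq e⟩)
    (P := P) (f₁ := fun j => isoClass (X₁ j)) (f₂ := fun j => isoClass (X₂ j))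
    (f₃ := fun j => isoClass (X₃ j))
    (by
      rintro j hj ⟨B⟩ ⟨B'⟩ h₁ h₃
      exact (hmem _).2 (hP j hj B B' ((hmem (_ ⊞ B)).1 h₁) ((hmem (_ ⊞ B')).1 h₃)))
    (isoClass A) (by
      refine AddSubgroup.closure_mono ?_ hA
      rintro _ ⟨X, hX, rfl⟩
      exact ⟨_, ⟨X, hX, rfl⟩, rfl⟩)
  exact ⟨X, Y, hX, hY, nonempty_iso_of_isoClass_eq h⟩

end IsoClasses

end GrothendieckGroup

/-! ### Split and direct sum conflations -/

namespace ExactCategory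

section Exact

variable {C : Type*} [Category* C] [Preadditive C] [HasZeroObject C] [HasBinaryBiproducts C]
  [ExactCategory C]

lemma isAdmissibleEpi_to_zero (X : C) : IsAdmissibleEpi shortExact (0 : X ⟶ (0 : C)) := by
  obtain ⟨Z, p, w, hS⟩ := mono_id X
  obtain ⟨-, ⟨h⟩⟩ := isKernelCokernelPair _ hS
  have hZ : IsZero Z := by
    rw [IsZero.iff_id_eq_zero]
    refine Cofork.IsColimit.hom_ext h ?_
    have : p = 0 := by simpa using w
    simp [this]
  exact ⟨X, 𝟙 X, by simp, shortExact_of_isos hS _ _ _ (Iso.refl _) (Iso.refl _) hZ.isoZero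
    (by simp) ((isZero_zero C).eq_of_tgt _ _)⟩

/-- Split sequences are conflations: the projection `X ⊞ Z ↠ Z` is a pullback of `X ↠ 0`. -/
lemma shortExact_of_splitting {S : ShortComplex C} (σ : S.Splitting) : shortExact S := by
  have h : IsPullback σ.r S.g (0 : S.X₁ ⟶ (0 : C)) 0 := by
    refine IsPullback.of_isLimit' ⟨by simp⟩ (PullbackCone.IsLimit.mk _
      (fun s => s.fst ≫ S.f + s.snd ≫ σ.s) ?_ ?_ ?_)
    · intro s
      simp [σ.f_r]
    · intro s
      simp [σ.s_g]
    · intro s m h₁ h₂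
      rw [← h₁, ← h₂, assoc, assoc, ← Preadditive.comp_add, σ.id, comp_id]
  exact shortExact_of_isLimit S.f S.g S.zero
    (isAdmissibleEpi_of_isPullback h (isAdmissibleEpi_to_zero _)) ⟨σ.fIsKernel⟩

lemma shortExact_biprod (A B : C) :
    shortExact (ShortComplex.mk (biprod.inl : A ⟶ A ⊞ B) biprod.snd (by simp)) :=
  shortExact_of_splitting (ShortComplex.Splitting.ofHasBinaryBiproduct A B)

/-- The direct sum of two conflations is a conflation. -/
lemma shortExact_biprod_map {S T : ShortComplex C} (hS : shortExact S) (hT : shortExact T) :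
    shortExact (ShortComplex.mk (biprod.map S.f T.f) (biprod.map S.g T.g)
      (by ext <;> simp)) := by
  have hSg : IsAdmissibleEpi shortExact S.g := ⟨_, _, _, hS⟩
  have hTg : IsAdmissibleEpi shortExact T.g := ⟨_, _, _, hT⟩
  have h₁ : IsPullback biprod.fst (biprod.map S.g (𝟙 T.X₂)) S.g biprod.fst := by
    refine IsPullback.of_isLimit' ⟨by simp⟩ (PullbackCone.IsLimit.mk _
      (fun s => biprod.lift s.fst (s.snd ≫ biprod.snd)) ?_ ?_ ?_)
    · intro s
      simp
    · intro s
      ext <;> simp [s.condition]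
    · intro s m h h'
      ext <;> simp [← h, ← h']
  have h₂ : IsPullback biprod.snd (biprod.map (𝟙 S.X₃) T.g) T.g biprod.snd := by
    refine IsPullback.of_isLimit' ⟨by simp⟩ (PullbackCone.IsLimit.mk _
      (fun s => biprod.lift (s.snd ≫ biprod.fst) s.fst) ?_ ?_ ?_)
    · intro s
      simp
    · intro s
      ext <;> simp [s.condition]
    · intro s m h h'
      ext <;> simp [← h, ← h']
  have hp : IsAdmissibleEpi shortExact (biprod.map S.g T.g) := by
    have : biprod.map S.g T.g = biprod.map S.g (𝟙 _) ≫ biprod.map (𝟙 _) T.g := by ext <;> simp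
    rw [this]
    exact epi_comp _ _ (isAdmissibleEpi_of_isPullback h₁ hSg)
      (isAdmissibleEpi_of_isPullback h₂ hTg)
  have := mono_of_shortExact hS
  have := mono_of_shortExact hT
  have : Mono (biprod.map S.f T.f) := ⟨fun u v h => by
    have e₁ : (u ≫ biprod.fst) ≫ S.f = (v ≫ biprod.fst) ≫ S.f := by
      simpa using h =≫ biprod.fst
    have e₂ : (u ≫ biprod.snd) ≫ T.f = (v ≫ biprod.snd) ≫ T.f := by
      simpa using h =≫ biprod.snd
    ext
    · exact (cancel_mono _).1 e₁
    · exact (cancel_mono _).1 e₂⟩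
  refine shortExact_of_isLimit _ _ _ hp
    ⟨KernelFork.IsLimit.ofι' _ _ (fun {A} k hk => Classical.indefiniteDescription _ ?_)⟩
  obtain ⟨a, ha⟩ := exists_lift_of_shortExact hS (k ≫ biprod.fst)
    (by simpa using hk =≫ biprod.fst)
  obtain ⟨b, hb⟩ := exists_lift_of_shortExact hT (k ≫ biprod.snd)
    (by simpa using hk =≫ biprod.snd)
  exact ⟨biprod.lift a b, by ext <;> simp [ha, hb]⟩

/-! ### The Grothendieck group of an exact category -/

lemma K₀.mk_eq_of_iso {A B : C} (e : A ≅ B) : K₀.mk A = K₀.mk B :=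
  congrArg (fun m => QuotientAddGroup.mk (FreeAbelianGroup.of m))
    (GrothendieckGroup.isoClass_eq e)

lemma K₀.mk_shortExact {S : ShortComplex C} (hS : shortExact S) :
    K₀.mk S.X₂ = K₀.mk S.X₁ + K₀.mk S.X₃ :=
  GrothendieckGroup.Presented.mk_eq (f₁ := fun S : ShortComplex C => Quotient.mk _ S.X₁)
    (f₂ := fun S : ShortComplex C => Quotient.mk _ S.X₂)
    (f₃ := fun S : ShortComplex C => Quotient.mk _ S.X₃) S hS

lemma K₀.mk_biprod (A B : C) : K₀.mk (A ⊞ B) = K₀.mk A + K₀.mk B :=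
  K₀.mk_shortExact (shortExact_biprod A B)

lemma K₀.mk_isZero {A : C} (hA : IsZero A) : K₀.mk A = 0 := by
  have := K₀.mk_shortExact (shortExact_zero hA hA hA 0 0 (by simp))
  simpa using this

lemma K₀.induction {p : K₀ C → Prop} (zero : p 0) (mk : ∀ A, p (K₀.mk A))
    (neg : ∀ x, p x → p (-x)) (add : ∀ x y, p x → p y → p (x + y)) (x : K₀ C) : p x :=
  GrothendieckGroup.Presented.induction zero (by rintro ⟨A⟩; exact mk A) neg add x

/-- The homomorphism from the Grothendieck group induced by an additive function on objects. -/
noncomputable def K₀.lift {M : Type*} [AddCommGroup M] (f : C → M)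
    (hf : ∀ A B, (A ≅ B) → f A = f B)
    (hf' : ∀ S : ShortComplex C, shortExact S → f S.X₂ = f S.X₁ + f S.X₃) : K₀ C →+ M :=
  GrothendieckGroup.Presented.lift (Quotient.lift f fun _ _ ⟨e⟩ => hf _ _ e) hf'

@[simp]
lemma K₀.lift_mk {M : Type*} [AddCommGroup M] (f : C → M) (hf : ∀ A B, (A ≅ B) → f A = f B)
    (hf' : ∀ S : ShortComplex C, shortExact S → f S.X₂ = f S.X₁ + f S.X₃) (A : C) :
    K₀.lift f hf hf' (K₀.mk A) = f A :=
  GrothendieckGroup.Presented.lift_mk _ _ _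

/-! ### Dense resolving and coresolving subcategories -/

/-- An object whose class lies in the subgroup generated by a dense additive subcategory `𝒳` closed
under extensions becomes an object of `𝒳` after adding some object of `𝒳`. -/
lemma exists_iso_of_mem_span {𝒳 : ObjectProperty C} (hd : IsDenseSubcategory 𝒳)
    (hadd : IsAdditiveSubcategory 𝒳)
    (hext : ∀ S : ShortComplex C, shortExact S → 𝒳 S.X₁ → 𝒳 S.X₃ → 𝒳 S.X₂) {A : C}
    (hA : K₀.mk A ∈ K₀.span 𝒳) : ∃ X Y, 𝒳 X ∧ 𝒳 Y ∧ Nonempty (A ⊞ X ≅ Y) :=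
  GrothendieckGroup.exists_iso_of_mem_closure hadd hd (P := fun S : ShortComplex C => shortExact S)
    (X₁ := fun S => S.X₁) (X₂ := fun S => S.X₂) (X₃ := fun S => S.X₃)
    (fun _ hS A B h₁ h₃ => hext _ (shortExact_biprod_map hS (shortExact_biprod A B)) h₁ h₃) A hA

lemma K₀.le_objects_span (𝒳 : ObjectProperty C) : 𝒳 ≤ K₀.objects (K₀.span 𝒳) :=
  fun A hA => AddSubgroup.subset_closure ⟨A, hA, rfl⟩

lemma K₀.objects_span_of_resolving {𝒢 𝒳 : ObjectProperty C} (h : 𝒳 ∈ denseResolving 𝒢) :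
    K₀.objects (K₀.span 𝒳) = 𝒳 := by
  refine le_antisymm (fun A hA => ?_) (K₀.le_objects_span 𝒳)
  obtain ⟨hd, h⟩ := h
  obtain ⟨X, Y, hX, hY, ⟨e⟩⟩ := exists_iso_of_mem_span hd h.additive h.extension hA
  have := h.additive.closedUnderIso
  exact h.kernel _ (shortExact_biprod A X) (𝒳.prop_of_iso e.symm hY) hX

lemma K₀.objects_span_of_coresolving {𝒢 𝒳 : ObjectProperty C} (h : 𝒳 ∈ denseCoresolving 𝒢) :
    K₀.objects (K₀.span 𝒳) = 𝒳 := by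
  refine le_antisymm (fun A hA => ?_) (K₀.le_objects_span 𝒳)
  obtain ⟨hd, h⟩ := h
  obtain ⟨X, Y, hX, hY, ⟨e⟩⟩ := exists_iso_of_mem_span hd h.additive h.extension hA
  have := h.additive.closedUnderIso
  exact h.cokernel _ (shortExact_biprod X A) hX
    (𝒳.prop_of_iso (e.symm ≪≫ biprod.braiding A X) hY)

/-- The kernel (resp. cokernel) of an approximation of `A` by the generator (resp. cogenerator) is
a complement of `A` modulo any subgroup containing the classes of `𝒢`. -/
lemma exists_mk_add_mk_mem {𝒢 : ObjectProperty C} (h𝒢 : IsGenerator 𝒢 ∨ IsCogenerator 𝒢)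
    {H : AddSubgroup (K₀ C)} (hH : H ∈ subgroupsContaining 𝒢) (A : C) :
    ∃ B, K₀.mk A + K₀.mk B ∈ H := by
  obtain h | h := h𝒢
  · obtain ⟨S, hS, hG, rfl⟩ := h A
    exact ⟨S.X₁, by rw [add_comm, ← K₀.mk_shortExact hS]; exact hH _ hG⟩
  · obtain ⟨S, hS, hG, rfl⟩ := h A
    exact ⟨S.X₃, by rw [← K₀.mk_shortExact hS]; exact hH _ hG⟩

lemma K₀.isDenseSubcategory_objects {𝒢 : ObjectProperty C}
    (h𝒢 : IsGenerator 𝒢 ∨ IsCogenerator 𝒢) {H : AddSubgroup (K₀ C)}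
    (hH : H ∈ subgroupsContaining 𝒢) : IsDenseSubcategory (K₀.objects H) := by
  intro A
  obtain ⟨B, hB⟩ := exists_mk_add_mk_mem h𝒢 hH A
  exact ⟨B, A ⊞ B, by rwa [K₀.objects, K₀.mk_biprod], ⟨Iso.refl _⟩⟩

lemma K₀.isAdditiveSubcategory_objects (H : AddSubgroup (K₀ C)) :
    IsAdditiveSubcategory (K₀.objects H) where
  closedUnderIso := ⟨fun e h => by rwa [K₀.objects, ← K₀.mk_eq_of_iso e]⟩
  containsZero := ⟨0, isZero_zero C, by
    rw [K₀.objects, K₀.mk_isZero (isZero_zero C)]; exact H.zero_mem⟩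
  biprod A B hA hB := by
    rw [K₀.objects, K₀.mk_biprod]
    exact H.add_mem hA hB

lemma K₀.objects_mem_denseResolving {𝒢 : ObjectProperty C}
    (h𝒢 : IsGenerator 𝒢 ∨ IsCogenerator 𝒢) {H : AddSubgroup (K₀ C)}
    (hH : H ∈ subgroupsContaining 𝒢) : K₀.objects H ∈ denseResolving 𝒢 := by
  refine ⟨K₀.isDenseSubcategory_objects h𝒢 hH, K₀.isAdditiveSubcategory_objects H, ?_, ?_, hH⟩
  · intro S hS h₁ h₃
    rw [K₀.objects, K₀.mk_shortExact hS]
    exact H.add_mem h₁ h₃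
  · intro S hS h₂ h₃
    rw [K₀.objects, K₀.mk_shortExact hS] at h₂
    exact (H.add_mem_cancel_right h₃).1 h₂

lemma K₀.objects_mem_denseCoresolving {𝒢 : ObjectProperty C}
    (h𝒢 : IsGenerator 𝒢 ∨ IsCogenerator 𝒢) {H : AddSubgroup (K₀ C)}
    (hH : H ∈ subgroupsContaining 𝒢) : K₀.objects H ∈ denseCoresolving 𝒢 := by
  refine ⟨K₀.isDenseSubcategory_objects h𝒢 hH, K₀.isAdditiveSubcategory_objects H, ?_, ?_, hH⟩
  · intro S hS h₁ h₃
    rw [K₀.objects, K₀.mk_shortExact hS]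
    exact H.add_mem h₁ h₃
  · intro S hS h₁ h₂
    rw [K₀.objects, K₀.mk_shortExact hS] at h₂
    exact (H.add_mem_cancel_left h₁).1 h₂

/-- A subgroup containing the (co)generator is generated by the classes of objects it contains:
every class is of the form `[A] - h` with `h` the class of an object in the subgroup. -/
lemma K₀.span_objects {𝒢 : ObjectProperty C} (h𝒢 : IsGenerator 𝒢 ∨ IsCogenerator 𝒢)
    {H : AddSubgroup (K₀ C)} (hH : H ∈ subgroupsContaining 𝒢) :
    K₀.span (K₀.objects H) = H := by
  apply le_antisymm
  · refine (AddSubgroup.closure_le _).2 ?_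
    rintro _ ⟨X, hX, rfl⟩
    exact hX
  · have key : ∀ x : K₀ C, ∃ A B : C, x = K₀.mk A - K₀.mk B ∧ K₀.mk B ∈ H := by
      intro x
      induction x using K₀.induction with
      | zero => exact ⟨0, 0, by simp, by rw [K₀.mk_isZero (isZero_zero C)]; exact H.zero_mem⟩
      | mk A => exact ⟨A, 0, by rw [K₀.mk_isZero (isZero_zero C), sub_zero],
          by rw [K₀.mk_isZero (isZero_zero C)]; exact H.zero_mem⟩
      | neg x h =>
        obtain ⟨A, B, rfl, hB⟩ := h
        obtain ⟨A', hA'⟩ := exists_mk_add_mk_mem h𝒢 hH A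
        refine ⟨B ⊞ A', A ⊞ A', ?_, by rwa [K₀.mk_biprod]⟩
        rw [K₀.mk_biprod, K₀.mk_biprod]
        abel
      | add x y hx hy =>
        obtain ⟨A, B, rfl, hB⟩ := hx
        obtain ⟨A', B', rfl, hB'⟩ := hy
        refine ⟨A ⊞ A', B ⊞ B', ?_, by rw [K₀.mk_biprod]; exact H.add_mem hB hB'⟩
        rw [K₀.mk_biprod, K₀.mk_biprod]
        abel
    intro x hx
    obtain ⟨A, B, rfl, hB⟩ := key x
    have hA : K₀.mk A ∈ H := by simpa using H.add_mem hx hB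
    exact AddSubgroup.sub_mem _ (K₀.le_objects_span (K₀.objects H) A hA)
      (K₀.le_objects_span (K₀.objects H) B hB)

end Exact

end ExactCategory

/-! ### Dense triangulated subcategories -/

namespace TriangulatedCategory

section

variable {T : Type*} [Category* T] [Preadditive T] [HasZeroObject T] [HasShift T ℤ]
  [∀ n : ℤ, (shiftFunctor T n).Additive] [Pretriangulated T]

lemma K₀.mk_eq_of_iso {A B : T} (e : A ≅ B) : K₀.mk A = K₀.mk B :=
  congrArg (fun m => QuotientAddGroup.mk (FreeAbelianGroup.of m))
    (GrothendieckGroup.isoClass_eq e)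

lemma K₀.mk_distTriang {S : Triangle T} (hS : S ∈ distTriang T) :
    K₀.mk S.obj₂ = K₀.mk S.obj₁ + K₀.mk S.obj₃ :=
  GrothendieckGroup.Presented.mk_eq (P := fun S : Triangle T => S ∈ distTriang T)
    (f₁ := fun S : Triangle T => Quotient.mk _ S.obj₁)
    (f₂ := fun S : Triangle T => Quotient.mk _ S.obj₂)
    (f₃ := fun S : Triangle T => Quotient.mk _ S.obj₃) S hS

lemma K₀.mk_biprod (A B : T) : K₀.mk (A ⊞ B) = K₀.mk A + K₀.mk B :=
  K₀.mk_distTriang (binaryBiproductTriangle_distinguished A B)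

lemma K₀.mk_isZero {A : T} (hA : IsZero A) : K₀.mk A = 0 := by
  have : K₀.mk A = K₀.mk A + K₀.mk (0 : T) :=
    K₀.mk_distTriang (contractible_distinguished A)
  rw [left_eq_add, K₀.mk_eq_of_iso (hA.isoZero).symm] at this
  exact this

lemma K₀.mk_shift_one (A : T) : K₀.mk (A⟦(1 : ℤ)⟧) = - K₀.mk A := by
  have : K₀.mk (0 : T) = K₀.mk A + K₀.mk (A⟦(1 : ℤ)⟧) :=
    K₀.mk_distTriang (rot_of_distTriang _ (contractible_distinguished A))
  rw [K₀.mk_isZero (isZero_zero T)] at this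
  rw [eq_neg_iff_add_eq_zero, add_comm, this]

lemma K₀.mk_shift (A : T) (n : ℤ) : K₀.mk (A⟦n⟧) = n.negOnePow • K₀.mk A := by
  have h (A : T) (n : ℤ) : K₀.mk (A⟦n + 1⟧) = - K₀.mk (A⟦n⟧) := by
    rw [← K₀.mk_shift_one, K₀.mk_eq_of_iso ((shiftFunctorAdd T n 1).app A)]
    rfl
  induction n using Int.induction_on with
  | zero =>
    rw [K₀.mk_eq_of_iso ((shiftFunctorZero T ℤ).app A)]
    simp
  | succ n hn => rw [h, hn, Int.negOnePow_succ, Units.neg_smul]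
  | pred n hn =>
    have h' := h A (-n - 1)
    rw [sub_add_cancel, hn] at h'
    rw [Int.negOnePow_sub, Int.negOnePow_one, mul_neg_one, Units.neg_smul, h', neg_neg]

lemma K₀.induction {p : K₀ T → Prop} (zero : p 0) (mk : ∀ A, p (K₀.mk A))
    (neg : ∀ x, p x → p (-x)) (add : ∀ x y, p x → p y → p (x + y)) (x : K₀ T) : p x :=
  GrothendieckGroup.Presented.induction zero (by rintro ⟨A⟩; exact mk A) neg add x

lemma K₀.mk_surjective : Function.Surjective (K₀.mk : T → K₀ T) := by
  intro x
  induction x using K₀.induction with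
  | zero => exact ⟨0, K₀.mk_isZero (isZero_zero T)⟩
  | mk A => exact ⟨A, rfl⟩
  | neg x h =>
    obtain ⟨A, rfl⟩ := h
    exact ⟨A⟦(1 : ℤ)⟧, K₀.mk_shift_one A⟩
  | add x y hx hy =>
    obtain ⟨A, rfl⟩ := hx
    obtain ⟨B, rfl⟩ := hy
    exact ⟨A ⊞ B, K₀.mk_biprod A B⟩

/-- The homomorphism from the Grothendieck group induced by an additive function on objects. -/
noncomputable def K₀.lift {M : Type*} [AddCommGroup M] (f : T → M)
    (hf : ∀ A B, (A ≅ B) → f A = f B)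
    (hf' : ∀ S ∈ distTriang T, f S.obj₂ = f S.obj₁ + f S.obj₃) : K₀ T →+ M :=
  GrothendieckGroup.Presented.lift (P := fun S : Triangle T => S ∈ distTriang T)
    (Quotient.lift f fun _ _ ⟨e⟩ => hf _ _ e) hf'

@[simp]
lemma K₀.lift_mk {M : Type*} [AddCommGroup M] (f : T → M) (hf : ∀ A B, (A ≅ B) → f A = f B)
    (hf' : ∀ S ∈ distTriang T, f S.obj₂ = f S.obj₁ + f S.obj₃) (A : T) :
    K₀.lift f hf hf' (K₀.mk A) = f A :=
  GrothendieckGroup.Presented.lift_mk _ _ _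

/-- A product over the two-point type is a binary biproduct. -/
noncomputable def piBoolIso (X : Bool → T) : ∏ᶜ X ≅ X true ⊞ X false where
  hom := biprod.lift (Pi.π X true) (Pi.π X false)
  inv := Pi.lift (fun b => match b with
    | true => biprod.fst
    | false => biprod.snd)
  hom_inv_id := by
    ext b
    cases b <;> simp
  inv_hom_id := by
    ext <;> simp

lemma exists_distTriang_biprod {S S' : Triangle T} (hS : S ∈ distTriang T)
    (hS' : S' ∈ distTriang T) : ∃ R ∈ distTriang T, Nonempty (R.obj₁ ≅ S.obj₁ ⊞ S'.obj₁) ∧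
      Nonempty (R.obj₂ ≅ S.obj₂ ⊞ S'.obj₂) ∧ Nonempty (R.obj₃ ≅ S.obj₃ ⊞ S'.obj₃) :=
  ⟨productTriangle (fun b : Bool => if b then S else S'),
    productTriangle_distinguished _ (by intro b; cases b <;> assumption),
    ⟨piBoolIso _⟩, ⟨piBoolIso _⟩, ⟨piBoolIso _⟩⟩

lemma IsTriangulatedSubcategory.isAdditiveSubcategory {𝒴 : ObjectProperty T}
    (h : IsTriangulatedSubcategory 𝒴) : IsAdditiveSubcategory 𝒴 where
  closedUnderIso := h.closedUnderIso
  containsZero := by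
    have := h.triangulated
    infer_instance
  biprod A B hA hB := by
    have := h.closedUnderIso
    have := h.triangulated
    exact 𝒴.ext_of_isTriangulatedClosed₂ _ (binaryBiproductTriangle_distinguished A B) hA hB

lemma K₀.le_objects_span (𝒴 : ObjectProperty T) : 𝒴 ≤ K₀.objects (K₀.span 𝒴) :=
  fun A hA => AddSubgroup.subset_closure ⟨A, hA, rfl⟩

/-- Thomason's theorem, first half: a dense triangulated subcategory is determined by the subgroup
of the Grothendieck group generated by its objects. -/
lemma K₀.objects_span {𝒴 : ObjectProperty T} (hd : IsDenseSubcategory 𝒴)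
    (h : IsTriangulatedSubcategory 𝒴) : K₀.objects (K₀.span 𝒴) = 𝒴 := by
  refine le_antisymm (fun A hA => ?_) (K₀.le_objects_span 𝒴)
  have := h.closedUnderIso
  have := h.triangulated
  obtain ⟨X, Y, hX, hY, ⟨e⟩⟩ :=
    GrothendieckGroup.exists_iso_of_mem_closure h.isAdditiveSubcategory hd
      (P := fun S : Triangle T => S ∈ distTriang T)
      (X₁ := fun S => S.obj₁) (X₂ := fun S => S.obj₂) (X₃ := fun S => S.obj₃)
      (fun S hS A B h₁ h₃ => by
        obtain ⟨R, hR, ⟨e₁⟩, ⟨e₂⟩, ⟨e₃⟩⟩ :=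
          exists_distTriang_biprod hS (binaryBiproductTriangle_distinguished A B)
        exact 𝒴.prop_of_iso e₂ (𝒴.ext_of_isTriangulatedClosed₂ R hR
          (𝒴.prop_of_iso e₁.symm h₁) (𝒴.prop_of_iso e₃.symm h₃))) A hA
  exact 𝒴.ext_of_isTriangulatedClosed₁ _ (binaryBiproductTriangle_distinguished A X)
    (𝒴.prop_of_iso e.symm hY) hX

lemma K₀.isTriangulatedSubcategory_objects (H : AddSubgroup (K₀ T)) :
    IsTriangulatedSubcategory (K₀.objects H) := by
  have hiso : (K₀.objects H).IsClosedUnderIsomorphisms :=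
    ⟨fun e h => by rwa [K₀.objects, ← K₀.mk_eq_of_iso e]⟩
  refine ⟨hiso, ?_⟩
  exact
    { exists_zero := ⟨0, isZero_zero T, by
        rw [K₀.objects, K₀.mk_isZero (isZero_zero T)]; exact H.zero_mem⟩
      isStableUnderShiftBy n :=
        { le_shift A hA := by
            rw [ObjectProperty.prop_shift_iff, K₀.objects, K₀.mk_shift]
            obtain h | h := Int.units_eq_one_or n.negOnePow <;> rw [h]
            · rwa [one_smul]
            · rw [Units.neg_smul, one_smul]
              exact H.neg_mem hA }
      toIsTriangulatedClosed₂ := .mk' fun S hS h₁ h₃ => by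
        rw [K₀.objects, K₀.mk_distTriang hS]
        exact H.add_mem h₁ h₃ }

/-- Thomason's theorem, second half: `A ⊞ A⟦1⟧` has class zero, so the subcategory attached to any
subgroup is dense. -/
lemma K₀.isDenseSubcategory_objects (H : AddSubgroup (K₀ T)) :
    IsDenseSubcategory (K₀.objects H) :=
  fun A => ⟨A⟦(1 : ℤ)⟧, A ⊞ A⟦(1 : ℤ)⟧, by
    rw [K₀.objects, K₀.mk_biprod, K₀.mk_shift_one, add_neg_cancel]
    exact H.zero_mem, ⟨Iso.refl _⟩⟩

lemma K₀.span_objects (H : AddSubgroup (K₀ T)) : K₀.span (K₀.objects H) = H := by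
  apply le_antisymm
  · refine (AddSubgroup.closure_le _).2 ?_
    rintro _ ⟨X, hX, rfl⟩
    exact hX
  · intro x hx
    obtain ⟨A, rfl⟩ := K₀.mk_surjective x
    exact K₀.le_objects_span _ A hx

end

end TriangulatedCategory

/-! ### Acyclic complexes in weakly idempotent complete exact categories -/

namespace ExactCategory

section WeaklyIdempotentComplete

lemma exists_splitting_of_retraction {C : Type*} [Category* C] [Preadditive C]
    (hC : IsWeaklyIdempotentComplete C) {B P : C} (g : B ⟶ P)
    (r : P ⟶ B) (hr : g ≫ r = 𝟙 B) : ∃ (D : C) (π : P ⟶ D) (w : g ≫ π = 0),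
      Nonempty (ShortComplex.mk g π w).Splitting := by
  have := (hC r g hr).2
  have hσ : cokernel.π g ≫ cokernel.desc g (𝟙 P - r ≫ g) (by simp [reassoc_of% hr]) =
      𝟙 P - r ≫ g := cokernel.π_desc _ _ _
  refine ⟨cokernel g, cokernel.π g, cokernel.condition g,
    ⟨{ r := r
       s := cokernel.desc g (𝟙 P - r ≫ g) (by simp [reassoc_of% hr])
       f_r := hr
       s_g := ?_
       id := ?_ }⟩⟩
  · rw [← cancel_epi (cokernel.π g)]
    dsimp
    rw [reassoc_of% hσ]
    simp
  · dsimp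
    rw [hσ]
    abel

variable {C : Type*} [Category* C] [Preadditive C] [HasZeroObject C] [HasBinaryBiproducts C]
  [ExactCategory C]

lemma epi_of_shortExact {S : ShortComplex C} (hS : shortExact S) : Epi S.g := by
  obtain ⟨-, ⟨h⟩⟩ := isKernelCokernelPair _ hS
  exact ⟨fun a b hab => Cofork.IsColimit.hom_ext h hab⟩

lemma exists_desc_of_shortExact {S : ShortComplex C} (hS : shortExact S) {A : C} (f : S.X₂ ⟶ A)
    (hf : S.f ≫ f = 0) : ∃ a : S.X₃ ⟶ A, S.g ≫ a = f := by
  obtain ⟨-, ⟨h⟩⟩ := isKernelCokernelPair _ hS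
  exact ⟨h.desc (CokernelCofork.ofπ f hf), h.fac _ WalkingParallelPair.one⟩

/-- If `f ≫ g` is an admissible monomorphism and `g` has a retraction, then `f` is an admissible
monomorphism. Weak idempotent completeness provides the complement of `g` and the kernel of the
induced retraction from the cokernel of `f ≫ g` to that complement; pulling back the cokernel of
`f ≫ g` along this kernel gives a cokernel of `f`. -/
lemma isAdmissibleMono_of_comp (hC : IsWeaklyIdempotentComplete C) {A B P : C} (f : A ⟶ B)
    (g : B ⟶ P) (r : P ⟶ B) (hr : g ≫ r = 𝟙 B) (h : IsAdmissibleMono shortExact (f ≫ g)) :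
    IsAdmissibleMono shortExact f := by
  obtain ⟨V, q, w, hS⟩ := h
  obtain ⟨D, π, hπ, ⟨σ⟩⟩ := exists_splitting_of_retraction hC g r hr
  have hg : Mono g := mono_of_mono_fac hr
  have hfg : Mono (f ≫ g) := mono_of_shortExact hS
  obtain ⟨t, ht⟩ := exists_desc_of_shortExact hS π (by simp [hπ])
  dsimp at t ht
  have hst : (σ.s ≫ q) ≫ t = 𝟙 D := by rw [assoc, ht]; exact σ.s_g
  have := (hC t (σ.s ≫ q) hst).1
  have hgt : (g ≫ q) ≫ t = 0 := by rw [assoc, ht, hπ]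
  have hc : kernel.lift t (g ≫ q) hgt ≫ kernel.ι t = g ≫ q := kernel.lift_ι _ _ _
  have hpb : IsPullback g (kernel.lift t (g ≫ q) hgt) q (kernel.ι t) := by
    refine IsPullback.of_isLimit' ⟨hc.symm⟩ (PullbackCone.IsLimit.mk _
      (fun s => s.fst ≫ σ.r) ?_ ?_ ?_)
    · intro s
      have hs : s.fst ≫ π = 0 := by
        rw [← ht, reassoc_of% s.condition, kernel.condition, comp_zero]
      have := s.fst ≫= σ.id
      dsimp at this
      rw [Preadditive.comp_add, reassoc_of% hs, zero_comp, add_zero, comp_id] at this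
      rw [assoc, this]
    · intro s
      have hs : s.fst ≫ π = 0 := by
        rw [← ht, reassoc_of% s.condition, kernel.condition, comp_zero]
      have := s.fst ≫= σ.id
      dsimp at this
      rw [Preadditive.comp_add, reassoc_of% hs, zero_comp, add_zero, comp_id] at this
      rw [← cancel_mono (kernel.ι t), assoc, hc, assoc, reassoc_of% this, s.condition]
    · intro s m h₁ h₂
      rw [← h₁, assoc]
      exact (comp_id m).symm.trans (congrArg (m ≫ ·) σ.f_r.symm)
  have hw : f ≫ kernel.lift t (g ≫ q) hgt = 0 := by
    rw [← cancel_mono (kernel.ι t), assoc, hc, ← assoc, w, zero_comp]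
  have hf : Mono f := mono_of_mono f g
  refine ⟨_, kernel.lift t (g ≫ q) hgt, hw, shortExact_of_isLimit _ _ _
    (isAdmissibleEpi_of_isPullback hpb ⟨_, _, _, hS⟩)
    ⟨KernelFork.IsLimit.ofι' _ _ (fun {X} x hx => Classical.indefiniteDescription _ ?_)⟩⟩
  obtain ⟨y, hy⟩ := exists_lift_of_shortExact hS (x ≫ g) (by
    dsimp
    rw [assoc, ← hc, reassoc_of% hx, zero_comp])
  dsimp at y hy
  exact ⟨y, by rw [← cancel_mono g, assoc, hy]⟩

/-- The inductive step for the acyclicity of a retract `N` of an acyclic complex `P`: a kernel of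
the differential in one degree is an admissible monomorphism, and its cokernel is a kernel of the
next differential. -/
lemma exists_shortExact_of_retract (hC : IsWeaklyIdempotentComplete C) {N P : CochainComplex C ℤ}
    (i : N ⟶ P) (r : P ⟶ N) (hir : i ≫ r = 𝟙 N) (hP : IsAcyclic P) {n m l : ℤ} (hnm : n + 1 = m)
    (hml : m + 1 = l) {W : C} (ι : W ⟶ N.X n) (wι : ι ≫ N.d n m = 0)
    (hι : IsLimit (KernelFork.ofι ι wι)) :
    ∃ (V : C) (p' : N.X n ⟶ V) (k : V ⟶ N.X m) (wk : k ≫ N.d m l = 0) (w : ι ≫ p' = 0),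
      N.d n m = p' ≫ k ∧ shortExact (ShortComplex.mk ι p' w) ∧
        Nonempty (IsLimit (KernelFork.ofι k wk)) := by
  obtain ⟨Z, j, p, hd, hS⟩ := hP
  have hj : ∀ n, Mono (j n) := fun n => mono_of_shortExact (hS n (n + 1) rfl).choose_spec
  have hp : ∀ n m h, Epi (p n m h) := fun n m h => epi_of_shortExact (hS n m h).choose_spec
  have wP : ∀ n m h, j n ≫ p n m h = 0 := fun n m h => (hS n m h).choose
  have hirf : ∀ n, i.f n ≫ r.f n = 𝟙 _ := fun n => by
    rw [← HomologicalComplex.comp_f, hir, HomologicalComplex.id_f]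
  have hιm : Mono ι := ⟨fun a b hab => Fork.IsLimit.hom_ext hι hab⟩
  obtain ⟨α, hα⟩ := exists_lift_of_shortExact (hS n m hnm).choose_spec (ι ≫ i.f n) (by
    rw [← cancel_mono (j m)]
    dsimp
    rw [assoc, assoc, ← hd, i.comm, reassoc_of% wι, zero_comp, zero_comp])
  dsimp at α hα
  obtain ⟨β, hβ⟩ : ∃ β : Z n ⟶ W, β ≫ ι = j n ≫ r.f n :=
    ⟨hι.lift (KernelFork.ofι (j n ≫ r.f n) (by
      rw [assoc, r.comm, hd n m hnm, assoc, reassoc_of% (wP n m hnm), zero_comp])),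
      hι.fac _ WalkingParallelPair.zero⟩
  have hαβ : α ≫ β = 𝟙 W := by
    rw [← cancel_mono ι, assoc, hβ, reassoc_of% hα, hirf, comp_id, id_comp]
  have hαm : IsAdmissibleMono shortExact α := by
    obtain ⟨D, π, w, ⟨σ⟩⟩ := exists_splitting_of_retraction hC α β hαβ
    exact ⟨D, π, w, shortExact_of_splitting σ⟩
  obtain ⟨V, p', w, hV⟩ := isAdmissibleMono_of_comp hC ι (i.f n) (r.f n) (hirf n) (by
    rw [← hα]
    exact mono_comp _ _ hαm ⟨_, _, _, (hS n m hnm).choose_spec⟩)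
  have hp' : Epi p' := epi_of_shortExact hV
  obtain ⟨k, hk⟩ := exists_desc_of_shortExact hV (N.d n m) wι
  dsimp at k hk
  obtain ⟨α', hα'⟩ := exists_desc_of_shortExact hV (i.f n ≫ p n m hnm) (by
    dsimp
    rw [← assoc, ← hα, assoc, wP, comp_zero])
  dsimp at α' hα'
  obtain ⟨β', hβ'⟩ := exists_desc_of_shortExact (hS n m hnm).choose_spec (r.f n ≫ p') (by
    dsimp
    rw [← assoc, ← hβ, assoc, w, comp_zero])
  dsimp at β' hβ'
  have hαβ' : α' ≫ β' = 𝟙 V := by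
    rw [← cancel_epi p', reassoc_of% hα', hβ', reassoc_of% (hirf n), comp_id]
  have hki : k ≫ i.f m = α' ≫ j m := by
    rw [← cancel_epi p', reassoc_of% hk, ← i.comm, hd n m hnm, reassoc_of% hα']
  have hβk : β' ≫ k = j m ≫ r.f m := by
    rw [← cancel_epi (p n m hnm), reassoc_of% hβ', hk, r.comm, hd n m hnm, assoc]
  have hkm : Mono k := by
    have : Mono α' := mono_of_mono_fac hαβ'
    have : Mono (k ≫ i.f m) := by rw [hki]; infer_instance
    exact mono_of_mono k (i.f m)
  have wk : k ≫ N.d m l = 0 := by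
    rw [← cancel_epi p', reassoc_of% hk, N.d_comp_d, comp_zero]
  refine ⟨V, p', k, wk, w, hk.symm, hV,
    ⟨KernelFork.IsLimit.ofι' _ _ (fun {T} t ht => Classical.indefiniteDescription _ ?_)⟩⟩
  obtain ⟨u, hu⟩ := exists_lift_of_shortExact (hS m l hml).choose_spec (t ≫ i.f m) (by
    rw [← cancel_mono (j l)]
    dsimp
    rw [assoc, assoc, ← hd, i.comm, reassoc_of% ht, zero_comp, zero_comp])
  dsimp at u hu
  exact ⟨u ≫ β', by rw [assoc, hβk, reassoc_of% hu, hirf, comp_id]⟩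

/-- A bounded below retract of an acyclic complex is acyclic. -/
lemma IsAcyclic.of_retract (hC : IsWeaklyIdempotentComplete C) {N P : CochainComplex C ℤ}
    (i : N ⟶ P) (r : P ⟶ N) (hir : i ≫ r = 𝟙 N) (hP : IsAcyclic P) {a : ℤ}
    (ha : ∀ n < a, IsZero (N.X n)) : IsAcyclic N := by
  -- the differentials vanish in degrees `< a`; from there on, kernels exist by induction
  have hker : ∀ n, HasKernel (N.d n (n + 1)) := by
    intro n
    obtain hn | hn := lt_or_ge n a
    · rw [(ha n hn).eq_of_src (N.d n (n + 1)) 0]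
      infer_instance
    · replace hn : a - 1 ≤ n := by lia
      induction n, hn using Int.leInduction with
      | base =>
        rw [(ha (a - 1) (by lia)).eq_of_src (N.d _ _) 0]
        infer_instance
      | succ n _ _ =>
        obtain ⟨V, p', k, wk, w, -, -, ⟨h⟩⟩ := exists_shortExact_of_retract hC i r hir hP
          (rfl : n + 1 = n + 1) rfl (kernel.ι (N.d n (n + 1))) (kernel.condition _)
          (kernelIsKernel _)
        exact ⟨⟨_, h⟩⟩
  have H : ∀ n m (h : n + 1 = m), ∃ p : N.X n ⟶ kernel (N.d m (m + 1)),
      N.d n m = p ≫ kernel.ι (N.d m (m + 1)) ∧ ∃ w : kernel.ι (N.d n (n + 1)) ≫ p = 0,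
        shortExact (ShortComplex.mk (kernel.ι (N.d n (n + 1))) p w) := by
    rintro n m rfl
    obtain ⟨V, p', k, wk, w, hd, hS, ⟨h⟩⟩ := exists_shortExact_of_retract hC i r hir hP
      (rfl : n + 1 = n + 1) rfl (kernel.ι (N.d n (n + 1))) (kernel.condition _)
      (kernelIsKernel _)
    let e : V ≅ kernel (N.d (n + 1) (n + 1 + 1)) :=
      IsLimit.conePointUniqueUpToIso
        (t := KernelFork.ofι (kernel.ι (N.d (n + 1) (n + 1 + 1))) (kernel.condition _))
        h (kernelIsKernel _)
    have he : e.hom ≫ kernel.ι (N.d (n + 1) (n + 1 + 1)) = k :=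
      IsLimit.conePointUniqueUpToIso_hom_comp
        (t := KernelFork.ofι (kernel.ι (N.d (n + 1) (n + 1 + 1))) (kernel.condition _))
        h (kernelIsKernel _) WalkingParallelPair.zero
    have w' : kernel.ι (N.d n (n + 1)) ≫ p' ≫ e.hom = 0 := by rw [reassoc_of% w, zero_comp]
    exact ⟨p' ≫ e.hom, by rw [assoc, he, hd], w',
      shortExact_of_isos hS _ _ w' (Iso.refl _) (Iso.refl _) e (by simp) (by simp)⟩
  choose p hp hS using H
  exact ⟨fun n => kernel (N.d n (n + 1)), fun n => kernel.ι _, p, hp, hS⟩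

lemma IsAcyclic.mappingCone_id (N : CochainComplex C ℤ) :
    IsAcyclic (CochainComplex.mappingCone (𝟙 N)) := by
  refine ⟨N.X, fun n => -(N.d n (n + 1) ≫ (CochainComplex.mappingCone.inl (𝟙 N)).v (n + 1) n
      (by lia)) + (CochainComplex.mappingCone.inr (𝟙 N)).f n,
    fun n m h => (CochainComplex.mappingCone.fst (𝟙 N)).1.v n m h +
      (CochainComplex.mappingCone.snd (𝟙 N)).v n n (add_zero n) ≫ N.d n m, ?_, ?_⟩
  · rintro n m rfl
    apply CochainComplex.mappingCone.ext_to _ (n + 1) (n + 1 + 1) rfl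
    · simp [CochainComplex.mappingCone.d_fst_v (𝟙 N) n (n + 1) (n + 1 + 1) rfl rfl]
    · simp [CochainComplex.mappingCone.d_snd_v (𝟙 N) n (n + 1) rfl]
  · rintro n m rfl
    refine ⟨by simp, shortExact_of_splitting
      { r := (CochainComplex.mappingCone.snd (𝟙 N)).v n n (add_zero n)
        s := (CochainComplex.mappingCone.inl (𝟙 N)).v (n + 1) n (by lia)
        f_r := by simp
        s_g := by simp
        id := ?_ }⟩
    dsimp
    apply CochainComplex.mappingCone.ext_to _ n (n + 1) rfl <;> simp

lemma IsAcyclic.biprod {K L : CochainComplex C ℤ} (hK : IsAcyclic K) (hL : IsAcyclic L) :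
    IsAcyclic (K ⊞ L) := by
  obtain ⟨Z, i, p, hdK, hSK⟩ := hK
  obtain ⟨W, j, q, hdL, hSL⟩ := hL
  have hXext : ∀ (n : ℤ) {A : C} (f g : A ⟶ (K ⊞ L).X n),
      f ≫ (biprod.fst : K ⊞ L ⟶ K).f n = g ≫ (biprod.fst : K ⊞ L ⟶ K).f n →
      f ≫ (biprod.snd : K ⊞ L ⟶ L).f n = g ≫ (biprod.snd : K ⊞ L ⟶ L).f n → f = g := by
    intro n A f g h₁ h₂
    rw [← cancel_mono (HomologicalComplex.biprodXIso K L n).hom]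
    ext <;> simpa
  have hfst : ∀ n, (HomologicalComplex.biprodXIso K L n).inv ≫
      (biprod.fst : K ⊞ L ⟶ K).f n = biprod.fst := fun n => by
    rw [← HomologicalComplex.biprodXIso_hom_fst, Iso.inv_hom_id_assoc]
  have hsnd : ∀ n, (HomologicalComplex.biprodXIso K L n).inv ≫
      (biprod.snd : K ⊞ L ⟶ L).f n = biprod.snd := fun n => by
    rw [← HomologicalComplex.biprodXIso_hom_snd, Iso.inv_hom_id_assoc]
  refine ⟨fun n => Z n ⊞ W n,
    fun n => biprod.map (i n) (j n) ≫ (HomologicalComplex.biprodXIso K L n).inv,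
    fun n m h => (HomologicalComplex.biprodXIso K L n).hom ≫ biprod.map (p n m h) (q n m h),
    ?_, ?_⟩
  · intro n m h
    apply hXext
    · simp [← HomologicalComplex.Hom.comm, hdK n m h, hfst]
    · simp [← HomologicalComplex.Hom.comm, hdL n m h, hsnd]
  · intro n m h
    obtain ⟨_, h₁⟩ := hSK n m h
    obtain ⟨_, h₂⟩ := hSL n m h
    have w : (biprod.map (i n) (j n) ≫ (HomologicalComplex.biprodXIso K L n).inv) ≫
        (HomologicalComplex.biprodXIso K L n).hom ≫ biprod.map (p n m h) (q n m h) = 0 := by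
      ext <;> simp [*]
    exact ⟨w, shortExact_of_isos (shortExact_biprod_map h₁ h₂) _ _ w (Iso.refl _)
      (HomologicalComplex.biprodXIso K L n).symm (Iso.refl _) (by simp) (by simp)⟩

/-- A bounded below complex that is a retract of an acyclic complex `P` up to homotopy is acyclic:
it is a retract of the direct sum of `P` and its own cone. -/
lemma IsAcyclic.of_homotopy_retract (hC : IsWeaklyIdempotentComplete C)
    {N P : CochainComplex C ℤ} (i : N ⟶ P) (r : P ⟶ N) (h : Homotopy (𝟙 N) (i ≫ r))
    (hP : IsAcyclic P) {a : ℤ} (ha : ∀ n < a, IsZero (N.X n)) : IsAcyclic N := by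
  let s : CochainComplex.mappingCone (𝟙 N) ⟶ N :=
    CochainComplex.mappingCone.desc (𝟙 N) (CochainComplex.HomComplex.Cochain.ofHomotopy h)
      (𝟙 N - i ≫ r) (by simp)
  have hs : CochainComplex.mappingCone.inr (𝟙 N) ≫ s = 𝟙 N - i ≫ r :=
    CochainComplex.mappingCone.inr_desc _ _ _ _
  refine IsAcyclic.of_retract hC (biprod.lift i (CochainComplex.mappingCone.inr (𝟙 N)))
    (biprod.desc r s) ?_ (hP.biprod (IsAcyclic.mappingCone_id N)) ha
  rw [biprod.lift_desc, hs]
  abel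

/-- In a weakly idempotent complete exact category the subcategory `Kac C` is closed under
retracts, and all its objects are acyclic complexes. -/
lemma isAcyclic_of_retract_Kac (hC : IsWeaklyIdempotentComplete C) {N M : Kb C} (i : N ⟶ M)
    (r : M ⟶ N) (hir : i ≫ r = 𝟙 N) (hM : Kac C M) : IsAcyclic N.obj.as := by
  obtain ⟨M', hM', ⟨e⟩⟩ := hM
  obtain ⟨a, b, hab⟩ := N.property
  obtain ⟨f : N.obj.as ⟶ M'.obj.as, hf⟩ := (HomotopyCategory.quotient _ _).map_surjective
    ((bounded C).ι.map (i ≫ e.hom))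
  obtain ⟨g : M'.obj.as ⟶ N.obj.as, hg⟩ := (HomotopyCategory.quotient _ _).map_surjective
    ((bounded C).ι.map (e.inv ≫ r))
  refine IsAcyclic.of_homotopy_retract hC f g (HomotopyCategory.homotopyOfEq _ _ ?_) hM'
    (fun n hn => hab n (Or.inl hn))
  have h : (bounded C).ι.map (i ≫ e.hom) ≫ (bounded C).ι.map (e.inv ≫ r) = 𝟙 _ := by
    rw [← Functor.map_comp, assoc, e.hom_inv_id_assoc, hir, CategoryTheory.Functor.map_id]
  rw [← hf, ← hg] at h
  exact (CategoryTheory.Functor.map_id _ _).trans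
    (h.symm.trans (Functor.map_comp (HomotopyCategory.quotient _ _) f g).symm)

end WeaklyIdempotentComplete

end ExactCategory

/-! ### Euler characteristics of bounded complexes -/

namespace ExactCategory

section EulerSum

/-- Shifting the summation index changes the sign of an alternating sum. -/
lemma finsum_negOnePow_smul_succ {M : Type*} [AddCommGroup M] (g : ℤ → M) :
    ∑ᶠ n : ℤ, n.negOnePow • g (n + 1) = -∑ᶠ n : ℤ, n.negOnePow • g n := by
  rw [← finsum_comp_equiv (Equiv.addRight (1 : ℤ)) (f := fun n : ℤ => n.negOnePow • g n),
    ← finsum_neg_distrib]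
  refine finsum_congr fun n => ?_
  simp [Int.negOnePow_succ]

lemma finite_support_negOnePow_smul {M : Type*} [AddCommGroup M] {g : ℤ → M} {a b : ℤ}
    (hg : ∀ n, n < a ∨ b < n → g n = 0) :
    (Function.support fun n : ℤ => n.negOnePow • g n).Finite := by
  refine (Set.finite_Icc a b).subset fun n hn => ?_
  by_contra h
  refine hn ?_
  rw [Set.mem_Icc, not_and_or, not_le, not_le] at h
  simp [hg n h]

variable {C : Type*} [Category* C] [Preadditive C] [HasZeroObject C] [HasBinaryBiproducts C]
  [ExactCategory C]

/-- The Euler characteristic `∑ (-1)ⁿ [Kⁿ]` of a bounded complex, in the Grothendieck group. For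
unbounded complexes it has no meaning. -/
noncomputable def eulerChar (K : CochainComplex C ℤ) : K₀ C :=
  ∑ᶠ n : ℤ, n.negOnePow • K₀.mk (K.X n)

lemma eulerChar_mappingCone {K L : CochainComplex C ℤ} (φ : K ⟶ L)
    (hK : bounded C ((HomotopyCategory.quotient _ _).obj K))
    (hL : bounded C ((HomotopyCategory.quotient _ _).obj L)) :
    eulerChar (CochainComplex.mappingCone φ) = eulerChar L - eulerChar K := by
  obtain ⟨a, b, h⟩ := hK
  obtain ⟨a', b', h'⟩ := hL
  have hX : ∀ n : ℤ, K₀.mk ((CochainComplex.mappingCone φ).X n) =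
      K₀.mk (K.X (n + 1)) + K₀.mk (L.X n) := fun n => by
    rw [← K₀.mk_biprod]
    exact K₀.mk_eq_of_iso (HomologicalComplex.homotopyCofiber.XIsoBiprod φ n (n + 1) rfl)
  have : eulerChar (CochainComplex.mappingCone φ) =
      ∑ᶠ n : ℤ, (n.negOnePow • K₀.mk (K.X (n + 1)) + n.negOnePow • K₀.mk (L.X n)) :=
    finsum_congr fun n => by rw [hX, smul_add]
  rw [this, finsum_add_distrib
    (finite_support_negOnePow_smul (a := a - 1) (b := b - 1)
      (g := fun n => K₀.mk (K.X (n + 1))) fun n hn => K₀.mk_isZero (h _ (by lia)))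
    (finite_support_negOnePow_smul (g := fun n => K₀.mk (L.X n))
      fun n hn => K₀.mk_isZero (h' _ hn)),
    finsum_negOnePow_smul_succ (fun n => K₀.mk (K.X n)), eulerChar, eulerChar]
  abel

lemma eulerChar_of_isAcyclic {N : CochainComplex C ℤ} (hN : IsAcyclic N)
    (hb : bounded C ((HomotopyCategory.quotient _ _).obj N)) : eulerChar N = 0 := by
  obtain ⟨a, b, h⟩ := hb
  obtain ⟨Z, i, p, -, hS⟩ := hN
  have hZ : ∀ n, n < a ∨ b < n → K₀.mk (Z n) = 0 := fun n hn => by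
    have := mono_of_shortExact (hS n (n + 1) rfl).choose_spec
    dsimp at this
    refine K₀.mk_isZero ((IsZero.iff_id_eq_zero _).2 ?_)
    rw [← cancel_mono (i n)]
    exact (h n hn).eq_of_tgt _ _
  have : eulerChar N = ∑ᶠ n : ℤ, (n.negOnePow • K₀.mk (Z n) + n.negOnePow • K₀.mk (Z (n + 1))) :=
    finsum_congr fun n => by
      rw [← smul_add]
      exact congrArg _ (K₀.mk_shortExact (hS n (n + 1) rfl).choose_spec)
  rw [this, finsum_add_distrib (finite_support_negOnePow_smul hZ)
    (finite_support_negOnePow_smul (a := a - 1) (b := b - 1)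
      (g := fun n => K₀.mk (Z (n + 1))) fun n hn => hZ _ (by lia)),
    finsum_negOnePow_smul_succ (fun n => K₀.mk (Z n)), add_neg_cancel]

lemma isAcyclic_of_Kac (hC : IsWeaklyIdempotentComplete C) {N : Kb C} (hN : Kac C N) :
    IsAcyclic N.obj.as :=
  isAcyclic_of_retract_Kac hC (𝟙 N) (𝟙 N) (comp_id _) hN

/-- The Euler characteristic is invariant under homotopy equivalences of bounded complexes: the
cone of a homotopy equivalence is contractible, hence acyclic. -/
lemma eulerChar_eq_of_iso (hC : IsWeaklyIdempotentComplete C) {N M : Kb C} (e : N ≅ M) :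
    eulerChar N.obj.as = eulerChar M.obj.as := by
  obtain ⟨f : N.obj.as ⟶ M.obj.as, hf⟩ :=
    (HomotopyCategory.quotient _ _).map_surjective ((bounded C).ι.map e.hom)
  have hf' : IsIso ((HomotopyCategory.quotient _ _).map f) := by
    rw [hf]
    exact ((bounded C).ι.mapIso e).isIso_hom
  have hb := bounded_mappingCone C f N.property M.property
  have hz : IsZero ((HomotopyCategory.quotient C (ComplexShape.up ℤ)).obj
      (CochainComplex.mappingCone f)) :=
    Triangle.isZero₃_of_isIso₁ _ (HomotopyCategory.mappingCone_triangleh_distinguished f) hf'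
  have hz' : IsZero (⟨_, hb⟩ : Kb C) := by
    rw [IsZero.iff_id_eq_zero]
    apply (bounded C).ι.map_injective
    exact hz.eq_of_src _ _
  have h := eulerChar_of_isAcyclic (isAcyclic_of_Kac hC ((Kac C).prop_of_isZero hz')) hb
  exact (sub_eq_zero.1 ((eulerChar_mappingCone f N.property M.property).symm.trans h)).symm

lemma eulerChar_distTriang (hC : IsWeaklyIdempotentComplete C) {T : Triangle (Kb C)}
    (hT : T ∈ distTriang (Kb C)) : eulerChar T.obj₂.obj.as =
      eulerChar T.obj₁.obj.as + eulerChar T.obj₃.obj.as := by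
  obtain ⟨f, ⟨e⟩⟩ := exists_iso_mappingCone _ ((bounded C).ι.map_distinguished T hT)
  have hb := bounded_mappingCone C f T.obj₁.property T.obj₂.property
  have h₃ : eulerChar T.obj₃.obj.as = eulerChar (CochainComplex.mappingCone f) :=
    eulerChar_eq_of_iso hC (M := ⟨_, hb⟩) ((bounded C).ι.preimageIso e)
  rw [h₃]
  exact (add_eq_of_eq_sub' (eulerChar_mappingCone f T.obj₁.property T.obj₂.property)).symm

lemma eulerChar_eq_of_trW (hC : IsWeaklyIdempotentComplete C) {N M : Kb C} {f : N ⟶ M}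
    (hf : (Kac C).trW f) : eulerChar N.obj.as = eulerChar M.obj.as := by
  obtain ⟨Z, g, h, hT, hZ⟩ := hf
  have : eulerChar M.obj.as = eulerChar N.obj.as + eulerChar Z.obj.as :=
    eulerChar_distTriang hC hT
  rw [this, eulerChar_of_isAcyclic (isAcyclic_of_Kac hC hZ) Z.property, add_zero]

/-- Since `Kac C` is closed under retracts, the morphisms inverted in `Dᵇ(C)` are those with cone
in `Kac C`. -/
lemma trW_of_isIso_Q_map (hC : IsWeaklyIdempotentComplete C) {N M : Kb C} (f : N ⟶ M)
    [hf : IsIso ((Kac C).trW.Q.map f)] : (Kac C).trW f := by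
  obtain ⟨Z, g, h, hT⟩ := distinguished_cocone_triangle f
  have hZ : IsZero ((Kac C).trW.Q.obj Z) :=
    Triangle.isZero₃_of_isIso₁ _ ((Kac C).trW.Q.map_distinguished _ hT) hf
  obtain ⟨Z', s, hs, fac⟩ := (MorphismProperty.map_eq_iff_postcomp (Kac C).trW.Q (Kac C).trW
    (𝟙 Z) 0).1 (hZ.eq_of_src _ _)
  rw [ObjectProperty.trW_iff'] at hs
  -- the identity of the cone `Z` is killed by a morphism with cocone `A` in `Kac C`, so it factors
  -- through `A`
  obtain ⟨A, u, v, hT', hA⟩ := hs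
  obtain ⟨q, hq⟩ := Triangle.coyoneda_exact₂ _ hT' (𝟙 Z) (fac.trans zero_comp)
  exact ⟨Z, g, h, hT, Z, isAcyclic_of_retract_Kac hC q u hq.symm hA, ⟨Iso.refl _⟩⟩

lemma eulerChar_eq_of_iso_Q (hC : IsWeaklyIdempotentComplete C) {N M : Kb C}
    (e : (Kac C).trW.Q.obj N ≅ (Kac C).trW.Q.obj M) :
    eulerChar N.obj.as = eulerChar M.obj.as := by
  obtain ⟨α, hα⟩ := Localization.exists_leftFraction (Kac C).trW.Q (Kac C).trW e.hom
  have hs := Localization.inverts (Kac C).trW.Q (Kac C).trW α.s α.hs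
  have : (Kac C).trW.Q.map α.f = e.hom ≫ (Kac C).trW.Q.map α.s := by
    rw [hα, MorphismProperty.LeftFraction.map_comp_map_s]
  have hf : IsIso ((Kac C).trW.Q.map α.f) := by
    rw [this]
    infer_instance
  rw [eulerChar_eq_of_trW hC (trW_of_isIso_Q_map hC α.f), eulerChar_eq_of_trW hC α.hs]

/-- The homomorphism `K₀(Dᵇ(C)) → K₀(C)` given by the Euler characteristic. -/
noncomputable def eulerHom (hC : IsWeaklyIdempotentComplete C) :
    TriangulatedCategory.K₀ (Db C) →+ K₀ C :=
  TriangulatedCategory.K₀.lift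
    (fun D => eulerChar ((Localization.Construction.objEquiv (Kac C).trW).symm D).obj.as)
    (fun _ _ e => eulerChar_eq_of_iso_Q hC e)
    (by
      rintro S ⟨T, e, hT⟩
      have h₁ := eulerChar_eq_of_iso_Q hC
        (N := (Localization.Construction.objEquiv (Kac C).trW).symm S.obj₁)
        (M := T.obj₁) (Triangle.π₁.mapIso e)
      have h₂ := eulerChar_eq_of_iso_Q hC
        (N := (Localization.Construction.objEquiv (Kac C).trW).symm S.obj₂)
        (M := T.obj₂) (Triangle.π₂.mapIso e)
      have h₃ := eulerChar_eq_of_iso_Q hC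
        (N := (Localization.Construction.objEquiv (Kac C).trW).symm S.obj₃)
        (M := T.obj₃) (Triangle.π₃.mapIso e)
      rw [h₁, h₂, h₃, eulerChar_distTriang hC hT])

lemma eulerHom_mk_Q (hC : IsWeaklyIdempotentComplete C) (N : Kb C) :
    eulerHom hC (TriangulatedCategory.K₀.mk ((Kac C).trW.Q.obj N)) = eulerChar N.obj.as :=
  TriangulatedCategory.K₀.lift_mk _ _ _ _

lemma eulerChar_single (A : C) :
    eulerChar ((HomologicalComplex.single C (ComplexShape.up ℤ) 0).obj A) = K₀.mk A := by
  rw [eulerChar, finsum_eq_single _ 0 (fun n hn => by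
    rw [K₀.mk_isZero (HomologicalComplex.isZero_single_obj_X _ _ _ _ hn), smul_zero]),
    Int.negOnePow_zero, one_smul]
  exact K₀.mk_eq_of_iso (HomologicalComplex.singleObjXSelf _ _ _)

lemma eulerHom_mk_toDb (hC : IsWeaklyIdempotentComplete C) (A : C) :
    eulerHom hC (TriangulatedCategory.K₀.mk ((toDb C).obj A)) = K₀.mk A :=
  (eulerHom_mk_Q hC _).trans (eulerChar_single A)

end EulerSum

end ExactCategory

/-! ### Dévissage of bounded complexes -/

namespace ExactCategory

section Devissage

variable {C : Type*} [Category* C] [Preadditive C]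

/-- The brutal truncation of `K` in degrees `> a`, as a complex with a map to `K`. -/
lemma exists_brutalTruncation [HasZeroObject C] (K : CochainComplex C ℤ) (a : ℤ) :
    ∃ (K' : CochainComplex C ℤ) (i : K' ⟶ K), (∀ n ≤ a, IsZero (K'.X n)) ∧
      ∀ n, a < n → IsIso (i.f n) := by
  have hX : ∀ n, ∃ (X : C) (i : X ⟶ K.X n) (r : K.X n ⟶ X),
      (n ≤ a → IsZero X) ∧ (a < n → i ≫ r = 𝟙 _ ∧ r ≫ i = 𝟙 _) := by
    intro n
    obtain hn | hn := le_or_gt n a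
    · exact ⟨0, 0, 0, fun _ => isZero_zero C, fun h => by lia⟩
    · exact ⟨K.X n, 𝟙 _, 𝟙 _, fun h => by lia, fun _ => ⟨comp_id _, comp_id _⟩⟩
  choose X i r hz hi using hX
  refine ⟨{ X := X
            d n m := i n ≫ K.d n m ≫ r m
            shape n m h := by rw [K.shape n m h, zero_comp, comp_zero]
            d_comp_d' n m l hnm _ := ?_ },
    { f := i
      comm' n m hnm := ?_ }, hz, fun n hn => ⟨r n, hi n hn⟩⟩
  · obtain hm | hm := le_or_gt m a
    · have : n + 1 = m := hnm
      exact (hz n (by lia)).eq_of_src _ _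
    · simp only [assoc]
      rw [reassoc_of% (hi m hm).2, K.d_comp_d_assoc, zero_comp, comp_zero]
  · obtain hm | hm := le_or_gt m a
    · have : n + 1 = m := hnm
      exact (hz n (by lia)).eq_of_src _ _
    · dsimp
      rw [assoc, assoc, (hi m hm).2, comp_id]

lemma isZero_Kb {N : Kb C} (h : IsZero N.obj) : IsZero N := by
  rw [IsZero.iff_id_eq_zero]
  apply (bounded C).ι.map_injective
  exact h.eq_of_src _ _

variable [HasZeroObject C]

lemma bounded_single (A : C) (a : ℤ) :
    bounded C ((HomotopyCategory.singleFunctor C a).obj A) :=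
  ⟨a, a, fun n hn => HomologicalComplex.isZero_single_obj_X (ComplexShape.up ℤ) a A n (by lia)⟩

variable [HasBinaryBiproducts C] [ExactCategory C]

/-- The class in `K₀(Dᵇ(C))` of a bounded complex. -/
noncomputable def derivedClass (N : Kb C) : TriangulatedCategory.K₀ (Db C) :=
  TriangulatedCategory.K₀.mk ((Kac C).trW.Q.obj N)

lemma derivedClass_eq_of_iso {N M : Kb C} (e : N ≅ M) : derivedClass N = derivedClass M :=
  TriangulatedCategory.K₀.mk_eq_of_iso ((Kac C).trW.Q.mapIso e)

lemma derivedClass_isZero {N : Kb C} (h : IsZero N) : derivedClass N = 0 :=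
  TriangulatedCategory.K₀.mk_isZero ((Kac C).trW.Q.map_isZero h)

lemma derivedClass_distTriang {T : Triangle (Kb C)} (hT : T ∈ distTriang (Kb C)) :
    derivedClass T.obj₂ = derivedClass T.obj₁ + derivedClass T.obj₃ :=
  TriangulatedCategory.K₀.mk_distTriang ((Kac C).trW.Q.map_distinguished T hT)

lemma derivedClass_of_Kac {N : Kb C} (hN : Kac C N) : derivedClass N = 0 := by
  have h : (Kac C).trW (0 : (0 : Kb C) ⟶ N) :=
    ObjectProperty.trW.mk _ (contractible_distinguished₁ N) hN
  have := Localization.inverts (Kac C).trW.Q (Kac C).trW _ h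
  exact (TriangulatedCategory.K₀.mk_eq_of_iso (asIso ((Kac C).trW.Q.map
    (0 : (0 : Kb C) ⟶ N)))).symm.trans (derivedClass_isZero (isZero_zero _))

lemma derivedClass_of_degreewiseSplit (S : ShortComplex (CochainComplex C ℤ))
    (σ : ∀ n, (S.map (HomologicalComplex.eval C _ n)).Splitting)
    (h₁ : bounded C ((HomotopyCategory.quotient _ _).obj S.X₁))
    (h₂ : bounded C ((HomotopyCategory.quotient _ _).obj S.X₂))
    (h₃ : bounded C ((HomotopyCategory.quotient _ _).obj S.X₃)) :
    derivedClass ⟨_, h₂⟩ = derivedClass ⟨_, h₁⟩ + derivedClass ⟨_, h₃⟩ := by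
  let f : (⟨_, h₁⟩ : Kb C) ⟶ ⟨_, h₂⟩ :=
    (bounded C).fullyFaithfulι.preimage ((HomotopyCategory.quotient _ _).map S.f)
  obtain ⟨Z, g, h, hT⟩ := distinguished_cocone_triangle f
  have hT' := (HomotopyCategory.distinguished_iff_iso_trianglehOfDegreewiseSplit _).2
    ⟨S, σ, ⟨Iso.refl _⟩⟩
  have e : Z.obj ≅ (HomotopyCategory.quotient _ _).obj S.X₃ :=
    Triangle.π₃.mapIso (isoTriangleOfIso₁₂ _ _ ((bounded C).ι.map_distinguished _ hT) hT'
      (Iso.refl _) (Iso.refl _) ((comp_id _).trans (id_comp _).symm))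
  exact (derivedClass_distTriang hT).trans (congrArg _
    (derivedClass_eq_of_iso (M := ⟨_, h₃⟩) ((bounded C).ι.preimageIso e)))

lemma derivedClass_single (A : C) (a : ℤ) :
    derivedClass ⟨_, bounded_single A a⟩ =
      a.negOnePow • TriangulatedCategory.K₀.mk ((toDb C).obj A) := by
  let e : (⟨_, bounded_single A a⟩ : Kb C) ≅ ((toKb C).obj A)⟦-a⟧ :=
    (bounded C).ι.preimageIso
      ((((HomotopyCategory.singleFunctors C).shiftIso (-a) a 0 (by lia)).app A).symm ≪≫
        (((bounded C).ι.commShiftIso (-a)).app ((toKb C).obj A)).symm)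
  rw [derivedClass_eq_of_iso e, ← Int.negOnePow_neg, ← TriangulatedCategory.K₀.mk_shift]
  exact TriangulatedCategory.K₀.mk_eq_of_iso (((Kac C).trW.Q.commShiftIso (-a)).app _)

lemma mk_toDb_isZero {A : C} (hA : IsZero A) :
    TriangulatedCategory.K₀.mk ((toDb C).obj A) = 0 :=
  derivedClass_isZero (isZero_Kb ((HomotopyCategory.singleFunctor C 0).map_isZero hA))

/-- The class of a bounded complex in `K₀(Dᵇ(C))` is the alternating sum of the classes of its
terms, by induction on its length. -/
lemma derivedClass_eq_finsum (N : Kb C) : derivedClass N =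
    ∑ᶠ n : ℤ, n.negOnePow • TriangulatedCategory.K₀.mk ((toDb C).obj (N.obj.as.X n)) := by
  suffices H : ∀ (k : ℕ) (a : ℤ) (K : CochainComplex C ℤ)
      (hK : bounded C ((HomotopyCategory.quotient _ _).obj K))
      (_ : ∀ n, n < a ∨ a + k ≤ n → IsZero (K.X n)), derivedClass ⟨_, hK⟩ =
        ∑ᶠ n : ℤ, n.negOnePow • TriangulatedCategory.K₀.mk ((toDb C).obj (K.X n)) by
    obtain ⟨a, b, h⟩ := N.property
    exact H (b + 1 - a).toNat a N.obj.as N.property (fun n hn => h n (by lia))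
  intro k
  induction k with
  | zero =>
    intro a K hK h
    have hK0 : IsZero K := by
      rw [IsZero.iff_id_eq_zero]
      ext n
      exact (h n (by lia)).eq_of_src _ _
    rw [derivedClass_isZero (isZero_Kb ((HomotopyCategory.quotient _ _).map_isZero hK0)),
      finsum_eq_zero_of_forall_eq_zero]
    intro n
    rw [mk_toDb_isZero (h n (by lia)), smul_zero]
  | succ k ih =>
    intro a K hK h
    -- `K` is a degreewise split extension of its lowest term, in degree `a`, by its truncation
    -- `K'` in degrees `> a`
    obtain ⟨K', i, hz, hi⟩ := exists_brutalTruncation K a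
    have hK' : ∀ n, n < a + 1 ∨ a + 1 + k ≤ n → IsZero (K'.X n) := by
      intro n hn
      obtain hn' | hn' := le_or_gt n a
      · exact hz n hn'
      · have := hi n hn'
        exact (h n (by lia)).of_iso (asIso (i.f n))
    have hb : bounded C ((HomotopyCategory.quotient _ _).obj K') :=
      ⟨a + 1, a + 1 + k, fun n hn => hK' n (by lia)⟩
    let p : K ⟶ (HomologicalComplex.single C (ComplexShape.up ℤ) a).obj (K.X a) :=
      HomologicalComplex.mkHomToSingle (𝟙 _) (fun j hj => by
        have : j + 1 = a := hj
        exact (h j (by lia)).eq_of_src _ _)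
    let S : ShortComplex (CochainComplex C ℤ) := ShortComplex.mk i p (by
      apply HomologicalComplex.hom_ext
      intro n
      obtain hn | hn := le_or_gt n a
      · exact (hz n hn).eq_of_src _ _
      · exact (HomologicalComplex.isZero_single_obj_X _ _ _ _ (by lia)).eq_of_tgt _ _)
    have σ : ∀ n, Nonempty (S.map (HomologicalComplex.eval C _ n)).Splitting := by
      intro n
      obtain hn | rfl | hn := lt_trichotomy n a
      · have h₁ : IsZero (K'.X n) := hz n hn.le
        have h₂ : IsZero (K.X n) := h n (by lia)
        exact ⟨.ofIsIsoOfIsZero _ ⟨0, h₁.eq_of_src _ _, h₂.eq_of_src _ _⟩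
          (HomologicalComplex.isZero_single_obj_X (ComplexShape.up ℤ) _ _ _ (by lia))⟩
      · refine ⟨.ofIsZeroOfIsIso _ (hz n le_rfl) ?_⟩
        change IsIso (p.f n)
        rw [HomologicalComplex.mkHomToSingle_f]
        infer_instance
      · exact ⟨.ofIsIsoOfIsZero _ (hi n hn)
          (HomologicalComplex.isZero_single_obj_X (ComplexShape.up ℤ) _ _ _ (by lia))⟩
    refine ((derivedClass_of_degreewiseSplit S (fun n => (σ n).some) hb hK
      (bounded_single _ a)).trans (congrArg₂ (· + ·) (ih (a + 1) K' hb hK')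
        (derivedClass_single (K.X a) a))).trans ?_
    have hterm : ∀ n : ℤ, n.negOnePow • TriangulatedCategory.K₀.mk ((toDb C).obj (K.X n)) =
        n.negOnePow • TriangulatedCategory.K₀.mk ((toDb C).obj (K'.X n)) +
          n.negOnePow • (if n = a then TriangulatedCategory.K₀.mk ((toDb C).obj (K.X a))
            else 0) := by
      intro n
      obtain hn | rfl | hn := lt_trichotomy n a
      · rw [mk_toDb_isZero (h n (by lia)), mk_toDb_isZero (hz n hn.le), if_neg hn.ne]
        simp
      · rw [mk_toDb_isZero (hz n le_rfl), if_pos rfl, smul_zero, zero_add]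
      · have := hi n hn
        rw [if_neg hn.ne', smul_zero, add_zero]
        exact congrArg _ (TriangulatedCategory.K₀.mk_eq_of_iso
          ((toDb C).mapIso (asIso (i.f n)).symm))
    rw [finsum_congr hterm, finsum_add_distrib
      (finite_support_negOnePow_smul fun n hn => mk_toDb_isZero (hK' n (hn.imp_right le_of_lt)))
      (finite_support_negOnePow_smul (a := a) (b := a) fun n hn => if_neg (by lia)),
      finsum_eq_single (fun n : ℤ => n.negOnePow • (if n = a then
        TriangulatedCategory.K₀.mk ((toDb C).obj (K.X a)) else 0)) a
        (fun n hn => by rw [if_neg hn, smul_zero]), if_pos rfl]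

/-! ### The Grothendieck group of the bounded derived category -/

/-- Conflations with matching ends can be spliced into an acyclic complex. -/
lemma exists_isAcyclic_of_shortExact (T : ℤ → ShortComplex C) (hT : ∀ n, shortExact (T n))
    (e : ∀ n, (T n).X₃ = (T (n + 1)).X₁) :
    ∃ N : CochainComplex C ℤ, IsAcyclic N ∧ ∀ n, N.X n = (T n).X₂ := by
  refine ⟨CochainComplex.of (fun n => (T n).X₂)
    (fun n => (T n).g ≫ eqToHom (e n) ≫ (T (n + 1)).f) (fun n => by simp),
    ⟨fun n => (T n).X₁, fun n => (T n).f,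
      fun n m h => (T n).g ≫ eqToHom (by rw [e n, h]), ?_, ?_⟩, fun n => rfl⟩
  · rintro n m rfl
    simp
  · rintro n m rfl
    have w : (T n).f ≫ (T n).g ≫ eqToHom (e n) = 0 := by simp
    exact ⟨w, shortExact_of_isos (hT n) _ _ w (Iso.refl _) (Iso.refl _) (eqToIso (e n))
      (by simp) (by simp)⟩

/-- A conflation, placed in degrees `0, 1, 2`, is an acyclic complex. -/
lemma exists_isAcyclic_three_term {S : ShortComplex C} (hS : shortExact S) :
    ∃ N : CochainComplex C ℤ, IsAcyclic N ∧ N.X 0 = S.X₁ ∧ N.X 1 = S.X₂ ∧ N.X 2 = S.X₃ ∧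
      ∀ n, n < 0 ∨ 2 < n → IsZero (N.X n) := by
  have h₀ : shortExact (ShortComplex.mk (0 : (0 : C) ⟶ S.X₁) (𝟙 _) (by simp)) :=
    shortExact_of_splitting (.ofIsZeroOfIsIso _ (isZero_zero C) (inferInstanceAs (IsIso (𝟙 _))))
  have h₂ : shortExact (ShortComplex.mk (𝟙 S.X₃) (0 : S.X₃ ⟶ (0 : C)) (by simp)) :=
    shortExact_of_splitting (.ofIsIsoOfIsZero _ (inferInstanceAs (IsIso (𝟙 _))) (isZero_zero C))
  have hz : shortExact (ShortComplex.mk (0 : (0 : C) ⟶ 0) (0 : (0 : C) ⟶ 0) (by simp)) :=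
    shortExact_zero (isZero_zero C) (isZero_zero C) (isZero_zero C) _ _ _
  obtain ⟨N, hN, hX⟩ := exists_isAcyclic_of_shortExact
    (fun n => if n = 0 then ShortComplex.mk (0 : (0 : C) ⟶ S.X₁) (𝟙 _) (by simp)
      else if n = 1 then S
      else if n = 2 then ShortComplex.mk (𝟙 S.X₃) (0 : S.X₃ ⟶ (0 : C)) (by simp)
      else ShortComplex.mk (0 : (0 : C) ⟶ 0) (0 : (0 : C) ⟶ 0) (by simp))
    (fun n => by split_ifs <;> assumption)
    (fun n => by split_ifs <;> first | rfl | lia)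
  refine ⟨N, hN, hX 0, hX 1, hX 2, fun n hn => ?_⟩
  rw [hX, if_neg (by lia), if_neg (by lia), if_neg (by lia)]
  exact isZero_zero C

/-- The canonical functor `C ⥤ Dᵇ(C)` is additive on conflations for the Grothendieck groups: a
conflation is an acyclic complex, whose class vanishes. -/
lemma mk_toDb_shortExact {S : ShortComplex C} (hS : shortExact S) :
    TriangulatedCategory.K₀.mk ((toDb C).obj S.X₂) =
      TriangulatedCategory.K₀.mk ((toDb C).obj S.X₁) +
        TriangulatedCategory.K₀.mk ((toDb C).obj S.X₃) := by
  obtain ⟨N, hN, h₀, h₁, h₂, hz⟩ := exists_isAcyclic_three_term hS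
  have hb : bounded C ((HomotopyCategory.quotient _ _).obj N) := ⟨0, 2, hz⟩
  have h : derivedClass ⟨_, hb⟩ = 0 := derivedClass_of_Kac ⟨_, hN, ⟨Iso.refl _⟩⟩
  have hs : (Function.support fun n : ℤ =>
      n.negOnePow • TriangulatedCategory.K₀.mk ((toDb C).obj (N.X n))) ⊆
      (({0, 1, 2} : Finset ℤ) : Set ℤ) := by
    intro n hn
    by_contra hn'
    refine hn ?_
    have : n < 0 ∨ 2 < n := by
      simp at hn'
      lia
    simp [mk_toDb_isZero (hz n this)]
  have h' : derivedClass ⟨_, hb⟩ =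
      ∑ᶠ n : ℤ, n.negOnePow • TriangulatedCategory.K₀.mk ((toDb C).obj (N.X n)) :=
    derivedClass_eq_finsum ⟨_, hb⟩
  rw [h, finsum_eq_sum_of_support_subset _ hs, Finset.sum_insert (by decide),
    Finset.sum_insert (by decide), Finset.sum_singleton, h₀, h₁, h₂, Int.negOnePow_zero,
    Int.negOnePow_one, Int.negOnePow_even 2 (by decide), one_smul, one_smul, Units.neg_smul,
    one_smul] at h'
  rw [← sub_eq_zero, ← neg_eq_zero, h']
  abel

/-- The homomorphism `K₀(C) → K₀(Dᵇ(C))` induced by the canonical functor. -/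
noncomputable def toDbHom : K₀ C →+ TriangulatedCategory.K₀ (Db C) :=
  K₀.lift (fun A => TriangulatedCategory.K₀.mk ((toDb C).obj A))
    (fun _ _ e => TriangulatedCategory.K₀.mk_eq_of_iso ((toDb C).mapIso e))
    (fun _ hS => mk_toDb_shortExact hS)

lemma toDbHom_mk (A : C) :
    toDbHom (K₀.mk A) = TriangulatedCategory.K₀.mk ((toDb C).obj A) :=
  K₀.lift_mk _ _ _ _

lemma toDbHom_eulerChar (N : Kb C) : toDbHom (eulerChar N.obj.as) = derivedClass N := by
  obtain ⟨a, b, h⟩ := N.property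
  rw [eulerChar, AddMonoidHom.map_finsum _
    (finite_support_negOnePow_smul fun n hn => K₀.mk_isZero (h n hn)), derivedClass_eq_finsum]
  refine finsum_congr fun n => ?_
  rw [← toDbHom_mk]
  obtain h | h := Int.units_eq_one_or n.negOnePow <;> rw [h] <;> simp

/-- The isomorphism `K₀(C) ≃ K₀(Dᵇ(C))`, with inverse the Euler characteristic. -/
noncomputable def derivedK₀Equiv (hC : IsWeaklyIdempotentComplete C) :
    K₀ C ≃+ TriangulatedCategory.K₀ (Db C) :=
  AddMonoidHom.toAddEquiv toDbHom (eulerHom hC)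
    (DFunLike.ext _ _ fun x => by
      induction x using K₀.induction with
      | zero => simp
      | mk A => exact (congrArg _ (toDbHom_mk A)).trans (eulerHom_mk_toDb hC A)
      | neg x h => rw [map_neg, h, map_neg]
      | add x y hx hy => rw [map_add, map_add, hx, hy])
    (DFunLike.ext _ _ fun x => by
      obtain ⟨D, rfl⟩ := TriangulatedCategory.K₀.mk_surjective x
      obtain ⟨N, rfl⟩ := (Localization.Construction.objEquiv (Kac C).trW).surjective D
      exact (congrArg _ (eulerHom_mk_Q hC N)).trans (toDbHom_eulerChar N))

end Devissage

end ExactCategory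

/-! ### The correspondences -/

namespace ExactCategory

section Main

variable {C : Type*} [Category* C] [Preadditive C] [HasZeroObject C] [HasBinaryBiproducts C]
  [ExactCategory C]

lemma K₀.span_mem_subgroupsContaining {𝒢 𝒳 : ObjectProperty C} (h : ∀ A, 𝒢 A → 𝒳 A) :
    K₀.span 𝒳 ∈ subgroupsContaining 𝒢 :=
  fun A hA => K₀.le_objects_span 𝒳 A (h A hA)

lemma derivedK₀Equiv_mk (hC : IsWeaklyIdempotentComplete C) (A : C) :
    derivedK₀Equiv hC (K₀.mk A) = TriangulatedCategory.K₀.mk ((toDb C).obj A) :=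
  toDbHom_mk A

variable {φ : K₀ C ≃+ TriangulatedCategory.K₀ (Db C)}

lemma mapsTo_comap_span (hφ : ∀ A : C, φ (K₀.mk A) =
      TriangulatedCategory.K₀.mk ((toDb C).obj A)) (𝒢 : ObjectProperty C) :
    Set.MapsTo (fun 𝒴 => (TriangulatedCategory.K₀.span 𝒴).comap φ.toAddMonoidHom)
      (denseTriangulated 𝒢) (subgroupsContaining 𝒢) := by
  intro 𝒴 h𝒴 A hA
  change φ (K₀.mk A) ∈ TriangulatedCategory.K₀.span 𝒴
  rw [hφ]
  exact TriangulatedCategory.K₀.le_objects_span 𝒴 _ (h𝒴.2.2 A hA)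

lemma mapsTo_objects_map (hφ : ∀ A : C, φ (K₀.mk A) =
      TriangulatedCategory.K₀.mk ((toDb C).obj A)) (𝒢 : ObjectProperty C) :
    Set.MapsTo (fun H => TriangulatedCategory.K₀.objects (H.map φ.toAddMonoidHom))
      (subgroupsContaining 𝒢) (denseTriangulated 𝒢) := by
  intro H hH
  refine ⟨TriangulatedCategory.K₀.isDenseSubcategory_objects _,
    TriangulatedCategory.K₀.isTriangulatedSubcategory_objects _, fun A hA => ?_⟩
  change TriangulatedCategory.K₀.mk _ ∈ _
  rw [← hφ]
  exact AddSubgroup.mem_map_of_mem φ.toAddMonoidHom (hH A hA)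

lemma invOn_denseTriangulated (φ : K₀ C ≃+ TriangulatedCategory.K₀ (Db C))
    (𝒢 : ObjectProperty C) :
    Set.InvOn (fun H => TriangulatedCategory.K₀.objects (H.map φ.toAddMonoidHom))
      (fun 𝒴 => (TriangulatedCategory.K₀.span 𝒴).comap φ.toAddMonoidHom)
      (denseTriangulated 𝒢) (subgroupsContaining 𝒢) := by
  refine ⟨fun 𝒴 h𝒴 => ?_, fun H _ => ?_⟩
  · dsimp
    rw [AddSubgroup.map_comap_eq_self_of_surjective φ.surjective]
    exact TriangulatedCategory.K₀.objects_span h𝒴.1 h𝒴.2.1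
  · dsimp
    rw [TriangulatedCategory.K₀.span_objects]
    exact AddSubgroup.comap_map_eq_self_of_injective φ.injective H

/-- Under the correspondences with subgroups, a dense triangulated subcategory restricts to the
subcategory of `C` attached to the same subgroup. -/
lemma inverseImage_toDb_eq (hφ : ∀ A : C, φ (K₀.mk A) =
      TriangulatedCategory.K₀.mk ((toDb C).obj A)) {𝒢 : ObjectProperty C}
    {𝒴 : ObjectProperty (Db C)} (h𝒴 : 𝒴 ∈ denseTriangulated 𝒢) :
    𝒴.inverseImage (toDb C) =
      K₀.objects ((TriangulatedCategory.K₀.span 𝒴).comap φ.toAddMonoidHom) := by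
  conv_lhs => rw [← TriangulatedCategory.K₀.objects_span h𝒴.1 h𝒴.2.1]
  ext A
  change TriangulatedCategory.K₀.mk ((toDb C).obj A) ∈ TriangulatedCategory.K₀.span 𝒴 ↔
    φ (K₀.mk A) ∈ TriangulatedCategory.K₀.span 𝒴
  rw [hφ]

end Main

end ExactCategory

theorem mainTheorem2 {E : Type u} [Category.{v} E] [Preadditive E] [HasZeroObject E]
    [HasBinaryBiproducts E] [ExactCategory E] [EssentiallySmall.{w} E]
    (hE : IsWeaklyIdempotentComplete E) (𝒢 : ObjectProperty E)
    (h𝒢 : ExactCategory.IsGenerator 𝒢 ∨ ExactCategory.IsCogenerator 𝒢) :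
    ∃ φ : ExactCategory.K₀ E ≃+ TriangulatedCategory.K₀ (ExactCategory.Db E),
      (∀ A : E, φ (ExactCategory.K₀.mk A) =
        TriangulatedCategory.K₀.mk ((ExactCategory.toDb E).obj A)) ∧
      -- dense triangulated subcategories and subgroups
      (Set.BijOn (fun 𝒴 => (TriangulatedCategory.K₀.span 𝒴).comap φ.toAddMonoidHom)
          (ExactCategory.denseTriangulated 𝒢) (ExactCategory.subgroupsContaining 𝒢) ∧
        Set.InvOn (fun H => TriangulatedCategory.K₀.objects (H.map φ.toAddMonoidHom))
          (fun 𝒴 => (TriangulatedCategory.K₀.span 𝒴).comap φ.toAddMonoidHom)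
          (ExactCategory.denseTriangulated 𝒢) (ExactCategory.subgroupsContaining 𝒢)) ∧
      ∀ 𝒮 : Set (ObjectProperty E),
        (𝒮 = ExactCategory.denseResolving 𝒢 ∨ 𝒮 = ExactCategory.denseCoresolving 𝒢) →
        -- dense (co)resolving subcategories and subgroups
        (Set.BijOn ExactCategory.K₀.span 𝒮 (ExactCategory.subgroupsContaining 𝒢) ∧
          Set.InvOn ExactCategory.K₀.objects ExactCategory.K₀.span
            𝒮 (ExactCategory.subgroupsContaining 𝒢)) ∧
        -- dense triangulated subcategories and dense (co)resolving subcategories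
        (Set.BijOn (fun 𝒴 => 𝒴.inverseImage (ExactCategory.toDb E))
            (ExactCategory.denseTriangulated 𝒢) 𝒮 ∧
          Set.InvOn (fun 𝒳 => TriangulatedCategory.K₀.objects
              ((ExactCategory.K₀.span 𝒳).map φ.toAddMonoidHom))
            (fun 𝒴 => 𝒴.inverseImage (ExactCategory.toDb E))
            (ExactCategory.denseTriangulated 𝒢) 𝒮) := by
  have hφ := ExactCategory.derivedK₀Equiv_mk hE
  generalize ExactCategory.derivedK₀Equiv hE = φ at hφ
  have hD := ExactCategory.invOn_denseTriangulated φ 𝒢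
  have hDto := ExactCategory.mapsTo_comap_span hφ 𝒢
  have hDfrom := ExactCategory.mapsTo_objects_map hφ 𝒢
  refine ⟨φ, hφ, ⟨hD.bijOn hDto hDfrom, hD⟩, fun 𝒮 h𝒮 => ?_⟩
  have hto : Set.MapsTo ExactCategory.K₀.span 𝒮 (ExactCategory.subgroupsContaining 𝒢) := by
    rintro 𝒳 h𝒳
    obtain rfl | rfl := h𝒮
    · exact ExactCategory.K₀.span_mem_subgroupsContaining h𝒳.2.contains
    · exact ExactCategory.K₀.span_mem_subgroupsContaining h𝒳.2.contains
  have hfrom : Set.MapsTo ExactCategory.K₀.objects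
      (ExactCategory.subgroupsContaining 𝒢) 𝒮 := by
    intro H hH
    obtain rfl | rfl := h𝒮
    · exact ExactCategory.K₀.objects_mem_denseResolving h𝒢 hH
    · exact ExactCategory.K₀.objects_mem_denseCoresolving h𝒢 hH
  have hS : Set.InvOn ExactCategory.K₀.objects ExactCategory.K₀.span
      𝒮 (ExactCategory.subgroupsContaining 𝒢) := by
    refine ⟨fun 𝒳 h𝒳 => ?_, fun H hH => ExactCategory.K₀.span_objects h𝒢 hH⟩
    obtain rfl | rfl := h𝒮
    · exact ExactCategory.K₀.objects_span_of_resolving h𝒳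
    · exact ExactCategory.K₀.objects_span_of_coresolving h𝒳
  -- restriction along `toDb` factors through the correspondences with subgroups
  have hres : ∀ 𝒴 ∈ ExactCategory.denseTriangulated 𝒢,
      𝒴.inverseImage (ExactCategory.toDb E) = ExactCategory.K₀.objects
        ((TriangulatedCategory.K₀.span 𝒴).comap φ.toAddMonoidHom) :=
    fun 𝒴 h𝒴 => ExactCategory.inverseImage_toDb_eq hφ h𝒴
  have hR : Set.InvOn (fun 𝒳 => TriangulatedCategory.K₀.objects
      ((ExactCategory.K₀.span 𝒳).map φ.toAddMonoidHom))
      (fun 𝒴 => 𝒴.inverseImage (ExactCategory.toDb E))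
      (ExactCategory.denseTriangulated 𝒢) 𝒮 := by
    refine ⟨fun 𝒴 h𝒴 => ?_, fun 𝒳 h𝒳 => ?_⟩
    · dsimp only
      rw [hres 𝒴 h𝒴, hS.2 (hDto h𝒴)]
      exact hD.1 h𝒴
    · dsimp only
      rw [hres _ (hDfrom (hto h𝒳))]
      exact (congrArg ExactCategory.K₀.objects (hD.2 (hto h𝒳))).trans (hS.1 h𝒳)
  refine ⟨⟨hS.bijOn hto hfrom, hS⟩, hR.bijOn (fun 𝒴 h𝒴 => ?_)
    (fun 𝒳 h𝒳 => hDfrom (hto h𝒳)), hR⟩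
  dsimp only
  rw [hres 𝒴 h𝒴]
  exact hfrom (hDto h𝒴)
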